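/- **Proposition.** A *limit group* is a finitely generated group $G$ such that for every finite subset $S\subset G$ there is a homomorphism from $G$ to a free group that is injective on $S$. Let $(\mathcal G,X)$ be a graph of groups over a connected graph $X$ (with injective maps from edge groups to vertex groups) whose fundamental group $\Gamma=\pi_1(\mathcal G,X)$ is a limit group. Let $e$ be an edge of $X$ whose edge group is trivial, let $Y$ be a connected component of $X\smallsetminus\{e\}$ (the graph with all vertices of $X$ and all edges other than $e$), and let $A=\pi_1(\mathcal G,Y)$ be the fundamental group of the restriction of $\mathcal G$ to $Y$. For $R\in\Gamma$, let the $e$-length $\ell_e(R)$ be defined as follows: if $R$ acts on the Bass–Serre tree of $(\mathcal G,X)$ without fixed vertex, then $\ell_e(R)$ is the number of edges lying over $e$ in the quotient $\langle R\rangle\backslash L$ of the axis $L$ of $R$; otherwise $\ell_e(R)=0$. If $R\in\Gamma$ satisfies $\ell_e(R)>0$, then the natural homomorphism $A\to\Gamma/N(R)$ is injective, where $N(R)$ is the normal closure of $R$ in $\Gamma$ (the homomorphism $A\to\Gamma$ is the one induced by the inclusion of $Y$ in $X$ together with any choice of a path in $(\mathcal G,X)$ joining the base vertices). -/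

import Mathlib

universe u u₁ u₂ u₃ u₄

set_option linter.checkUnivs false

/-- A limit group: a finitely generated group such that every finite subset is mapped injectively
by some homomorphism to a free group. (As the group is finitely generated, only free groups of
finite rank matter, so the universe of the free basis plays no role.) -/
def IsLimitGroup (Γ : Type u) [Group Γ] : Prop :=
  Group.FG Γ ∧ ∀ S : Finset Γ, ∃ (ι : Type u) (φ : Γ →* FreeGroup ι), Set.InjOn φ (S : Set Γ)

/-- A graph, loops and multiple edges allowed, with vertex set `V` and set of (geometric) edges `E`.
Each edge comes with a chosen orientation; the oriented edges of the graph in the sense of Serre are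
the elements of `E × Bool`, where `(e, true)` is `e` and `(e, false)` is its inverse. -/
structure OrGraph (V : Type u₁) (E : Type u₂) where
  src : E → V
  tgt : E → V

namespace OrGraph

variable {V : Type u₁} {E : Type u₂}

/-- The initial vertex of an oriented edge. -/
def ini (X : OrGraph V E) (d : E × Bool) : V := if d.2 then X.src d.1 else X.tgt d.1

/-- The terminal vertex of an oriented edge. -/
def ter (X : OrGraph V E) (d : E × Bool) : V := if d.2 then X.tgt d.1 else X.src d.1

/-- A subgraph: sets of vertices and edges, containing the end points of its edges. -/
structure Subgraph (X : OrGraph V E) where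
  verts : Set V
  edges : Set E
  src_mem : ∀ f ∈ edges, X.src f ∈ verts
  tgt_mem : ∀ f ∈ edges, X.tgt f ∈ verts

/-- The whole graph as a subgraph. -/
def whole (X : OrGraph V E) : X.Subgraph where
  verts := Set.univ
  edges := Set.univ
  src_mem _ _ := trivial
  tgt_mem _ _ := trivial

/-- `X ∖ {e}`: all vertices, and all edges other than `e`. -/
def deleteEdge (X : OrGraph V E) (e : E) : X.Subgraph where
  verts := Set.univ
  edges := {f | f ≠ e}
  src_mem _ _ := trivial
  tgt_mem _ _ := trivial

namespace Subgraph

variable {X : OrGraph V E}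

/-- Two vertices are joined by a path that runs through edges of `Z` (in either direction). -/
def Joined (Z : X.Subgraph) : V → V → Prop :=
  Relation.EqvGen fun v w => ∃ f ∈ Z.edges, X.src f = v ∧ X.tgt f = w

/-- `Y` is a connected component of `Z`. -/
def IsComponentOf (Y Z : X.Subgraph) : Prop :=
  ∃ v ∈ Z.verts, Y.verts = {w | w ∈ Z.verts ∧ Z.Joined v w} ∧
    Y.edges = {f | f ∈ Z.edges ∧ X.src f ∈ Y.verts}

/-- A subgraph as a graph in its own right. -/
abbrev toGraph (Y : X.Subgraph) : OrGraph Y.verts Y.edges where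
  src f := ⟨X.src f.1, Y.src_mem f.1 f.2⟩
  tgt f := ⟨X.tgt f.1, Y.tgt_mem f.1 f.2⟩

end Subgraph

/-- Any two vertices are joined by an edge path, and there is at least one vertex. -/
def Connected (X : OrGraph V E) : Prop :=
  Nonempty V ∧ ∀ v w : V, X.whole.Joined v w

end OrGraph

/-- A graph of groups over the graph `X`: vertex groups, edge groups, and for each edge an
injective homomorphism from its group into the group of each of its two ends. -/
structure GraphOfGroups {V : Type u₁} {E : Type u₂} (X : OrGraph V E) where
  vGrp : V → Type u₃
  eGrp : E → Type u₄
  [vGroup : ∀ v, Group (vGrp v)]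
  [eGroup : ∀ e, Group (eGrp e)]
  toSrc : ∀ e, eGrp e →* vGrp (X.src e)
  toTgt : ∀ e, eGrp e →* vGrp (X.tgt e)
  toSrc_injective : ∀ e, Function.Injective (toSrc e)
  toTgt_injective : ∀ e, Function.Injective (toTgt e)

attribute [instance] GraphOfGroups.vGroup GraphOfGroups.eGroup

namespace GraphOfGroups

variable {V : Type u₁} {E : Type u₂} {X : OrGraph V E}

/-- The restriction of a graph of groups to a subgraph. -/
abbrev restrict (G : GraphOfGroups.{u₁, u₂, u₃, u₄} X) (Y : X.Subgraph) :
    GraphOfGroups.{u₁, u₂, u₃, u₄} Y.toGraph where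
  vGrp v := G.vGrp v.1
  eGrp f := G.eGrp f.1
  toSrc f := G.toSrc f.1
  toTgt f := G.toTgt f.1
  toSrc_injective f := G.toSrc_injective f.1
  toTgt_injective f := G.toTgt_injective f.1

/-- The free product of all vertex groups and of the free group on the edges. -/
abbrev FreePathGroup (G : GraphOfGroups.{u₁, u₂, u₃, u₄} X) : Type (max u₁ u₂ u₃) :=
  Monoid.Coprod (Monoid.CoprodI G.vGrp) (FreeGroup E)

/-- The relators `e · (g at the end of e) · e⁻¹ · (g at the origin of e)⁻¹`. -/
def relators (G : GraphOfGroups.{u₁, u₂, u₃, u₄} X) : Set G.FreePathGroup :=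
  {x | ∃ (e : E) (g : G.eGrp e), x =
    Monoid.Coprod.inr (FreeGroup.of e) *
      Monoid.Coprod.inl (Monoid.CoprodI.of (G.toTgt e g)) *
      (Monoid.Coprod.inr (FreeGroup.of e))⁻¹ *
      (Monoid.Coprod.inl (Monoid.CoprodI.of (G.toSrc e g)))⁻¹}

/-- Serre's group `F(𝒢, X)`: the free product of the vertex groups and of the free group on the
edges, modulo `e · (g at the end of e) · e⁻¹ = (g at the origin of e)` for `g` in the group
of `e`. -/
abbrev PathGroup (G : GraphOfGroups.{u₁, u₂, u₃, u₄} X) : Type (max u₁ u₂ u₃) :=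
  G.FreePathGroup ⧸ Subgroup.normalClosure G.relators

/-- The canonical map of a vertex group to `F(𝒢, X)`. -/
def ofVert (G : GraphOfGroups.{u₁, u₂, u₃, u₄} X) (v : V) : G.vGrp v →* G.PathGroup :=
  (QuotientGroup.mk' (Subgroup.normalClosure G.relators)).comp
    (Monoid.Coprod.inl.comp Monoid.CoprodI.of)

/-- The element of `F(𝒢, X)` given by an edge (in its chosen orientation). -/
def ofEdge (G : GraphOfGroups.{u₁, u₂, u₃, u₄} X) (e : E) : G.PathGroup :=
  QuotientGroup.mk' (Subgroup.normalClosure G.relators) (Monoid.Coprod.inr (FreeGroup.of e))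

theorem ofEdge_mul_toTgt (G : GraphOfGroups.{u₁, u₂, u₃, u₄} X) (e : E) (g : G.eGrp e) :
    G.ofEdge e * G.ofVert _ (G.toTgt e g) * (G.ofEdge e)⁻¹ = G.ofVert _ (G.toSrc e g) := by
  rw [← mul_inv_eq_one]
  have h : (Monoid.Coprod.inr (FreeGroup.of e) *
      Monoid.Coprod.inl (Monoid.CoprodI.of (G.toTgt e g)) *
      (Monoid.Coprod.inr (FreeGroup.of e))⁻¹ *
      (Monoid.Coprod.inl (Monoid.CoprodI.of (G.toSrc e g)))⁻¹ : G.FreePathGroup) ∈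
      Subgroup.normalClosure G.relators :=
    Subgroup.subset_normalClosure ⟨e, g, rfl⟩
  exact (QuotientGroup.eq_one_iff _).2 h

/-- `G.IsPath v w x`: the element `x` of `F(𝒢, X)` is represented by a path from `v` to `w`, i.e.
by a word `g₀ d₁ g₁ d₂ ⋯ dₙ gₙ` where `d₁ ⋯ dₙ` is an edge path from `v` to `w` and each `gᵢ` lies
in the group of the `i`-th vertex of that path. -/
inductive IsPath (G : GraphOfGroups.{u₁, u₂, u₃, u₄} X) : V → V → G.PathGroup → Prop
  | vert (v : V) (g : G.vGrp v) : IsPath G v v (G.ofVert v g)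
  | edge (e : E) : IsPath G (X.src e) (X.tgt e) (G.ofEdge e)
  | edgeInv (e : E) : IsPath G (X.tgt e) (X.src e) (G.ofEdge e)⁻¹
  | mul {v w z : V} {x y : G.PathGroup} :
      IsPath G v w x → IsPath G w z y → IsPath G v z (x * y)

theorem IsPath.inv {G : GraphOfGroups.{u₁, u₂, u₃, u₄} X} {v w : V} {x : G.PathGroup}
    (h : G.IsPath v w x) : G.IsPath w v x⁻¹ := by
  induction h with
  | vert v g => rw [← map_inv]; exact .vert v g⁻¹
  | edge e => exact .edgeInv e
  | edgeInv e => rw [inv_inv]; exact .edge e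
  | mul _ _ h₁ h₂ => rw [mul_inv_rev]; exact .mul h₂ h₁

/-- The fundamental group `π₁(𝒢, X, x₀)`: the elements of `F(𝒢, X)` represented by closed paths
at `x₀`. -/
def piOne (G : GraphOfGroups.{u₁, u₂, u₃, u₄} X) (x₀ : V) : Subgroup G.PathGroup where
  carrier := {x | G.IsPath x₀ x₀ x}
  mul_mem' h₁ h₂ := IsPath.mul h₁ h₂
  one_mem' := by
    have h := IsPath.vert (G := G) x₀ 1
    rwa [map_one] at h
  inv_mem' h := IsPath.inv h

section NaturalMap

/-- The natural map from the free product of the groups of `Y` and of the free group on the edges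
of `Y` to `F(𝒢, X)`, for a subgraph `Y` of `X`. -/
def freePathGroupMap (G : GraphOfGroups.{u₁, u₂, u₃, u₄} X) (Y : X.Subgraph) :
    (G.restrict Y).FreePathGroup →* G.PathGroup :=
  Monoid.Coprod.lift
    (Monoid.CoprodI.lift (M := (G.restrict Y).vGrp) fun v => G.ofVert v.1)
    (FreeGroup.lift fun f : Y.edges => G.ofEdge f.1)

theorem freePathGroupMap_vert (G : GraphOfGroups.{u₁, u₂, u₃, u₄} X) (Y : X.Subgraph)
    (v : Y.verts) (g : (G.restrict Y).vGrp v) :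
    G.freePathGroupMap Y (Monoid.Coprod.inl (Monoid.CoprodI.of g)) = G.ofVert v.1 g := by
  rw [freePathGroupMap, Monoid.Coprod.lift_apply_inl, Monoid.CoprodI.lift_of]

theorem freePathGroupMap_edge (G : GraphOfGroups.{u₁, u₂, u₃, u₄} X) (Y : X.Subgraph)
    (f : Y.edges) :
    G.freePathGroupMap Y (Monoid.Coprod.inr (FreeGroup.of f)) = G.ofEdge f.1 := by
  rw [freePathGroupMap, Monoid.Coprod.lift_apply_inr, FreeGroup.lift_apply_of]

/-- The natural map `F(𝒢|Y, Y) → F(𝒢, X)` for a subgraph `Y` of `X`. -/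
def pathGroupMap (G : GraphOfGroups.{u₁, u₂, u₃, u₄} X) (Y : X.Subgraph) :
    (G.restrict Y).PathGroup →* G.PathGroup :=
  QuotientGroup.lift (Subgroup.normalClosure (G.restrict Y).relators) (G.freePathGroupMap Y) (by
    intro x hx
    refine (Subgroup.normalClosure_le_normal (N := (G.freePathGroupMap Y).ker) ?_) hx
    rintro _ ⟨f, g, rfl⟩
    rw [SetLike.mem_coe, MonoidHom.mem_ker, map_mul, map_mul, map_mul, map_inv, map_inv,
      freePathGroupMap_vert, freePathGroupMap_vert, freePathGroupMap_edge, mul_inv_eq_one]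
    exact G.ofEdge_mul_toTgt f.1 g)

theorem pathGroupMap_ofVert (G : GraphOfGroups.{u₁, u₂, u₃, u₄} X) (Y : X.Subgraph)
    (v : Y.verts) (g : (G.restrict Y).vGrp v) :
    G.pathGroupMap Y ((G.restrict Y).ofVert v g) = G.ofVert v.1 g :=
  G.freePathGroupMap_vert Y v g

theorem pathGroupMap_ofEdge (G : GraphOfGroups.{u₁, u₂, u₃, u₄} X) (Y : X.Subgraph)
    (f : Y.edges) :
    G.pathGroupMap Y ((G.restrict Y).ofEdge f) = G.ofEdge f.1 :=
  G.freePathGroupMap_edge Y f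

theorem IsPath.map {G : GraphOfGroups.{u₁, u₂, u₃, u₄} X} {Y : X.Subgraph} {v w : Y.verts}
    {x : (G.restrict Y).PathGroup} (h : (G.restrict Y).IsPath v w x) :
    G.IsPath v.1 w.1 (G.pathGroupMap Y x) := by
  induction h with
  | vert v g => exact G.pathGroupMap_ofVert Y v g ▸ IsPath.vert v.1 g
  | edge e => rw [pathGroupMap_ofEdge]; exact .edge e.1
  | edgeInv e => rw [map_inv, pathGroupMap_ofEdge]; exact .edgeInv e.1
  | mul _ _ h₁ h₂ => rw [map_mul]; exact .mul h₁ h₂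

/-- The natural map `π₁(𝒢|Y, Y, y₀) → π₁(𝒢, X, x₀)` determined by a path `c` from `x₀` to `y₀`,
namely `a ↦ c a c⁻¹`. (For `x₀ = y₀` and `c = 1` this is the map induced by the inclusion of `Y`;
another `c` changes it by an inner automorphism of `π₁(𝒢, X, x₀)`.) -/
def piOneMap (G : GraphOfGroups.{u₁, u₂, u₃, u₄} X) (Y : X.Subgraph) (y₀ : Y.verts) (x₀ : V)
    (c : G.PathGroup) (hc : G.IsPath x₀ y₀.1 c) :
    (G.restrict Y).piOne y₀ →* G.piOne x₀ where
  toFun a := ⟨c * G.pathGroupMap Y a.1 * c⁻¹, (hc.mul (IsPath.map a.2)).mul hc.inv⟩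
  map_one' := by ext; simp
  map_mul' a b := by ext; simp

end NaturalMap

section BassSerreTree

/-- The image of a vertex group in `F(𝒢, X)`. -/
def vertSubgroup (G : GraphOfGroups.{u₁, u₂, u₃, u₄} X) (v : V) : Subgroup G.PathGroup :=
  (G.ofVert v).range

/-- The image of an edge group in `F(𝒢, X)`, through the group of the origin of the edge. -/
def edgeSubgroup (G : GraphOfGroups.{u₁, u₂, u₃, u₄} X) (e : E) : Subgroup G.PathGroup :=
  ((G.ofVert (X.src e)).comp (G.toSrc e)).range

theorem edgeSubgroup_le (G : GraphOfGroups.{u₁, u₂, u₃, u₄} X) (e : E) :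
    G.edgeSubgroup e ≤ G.vertSubgroup (X.src e) := by
  rintro _ ⟨g, rfl⟩
  exact ⟨G.toSrc e g, rfl⟩

/-- Vertices of the Bass–Serre tree based at `x₀`: over the vertex `v` of `X` lie the cosets
`p · 𝒢_v`, where `p` is (the class of) a path from `x₀` to `v`. -/
def TreeVert (G : GraphOfGroups.{u₁, u₂, u₃, u₄} X) (x₀ : V) : Type (max u₁ u₂ u₃) :=
  Σ v : V, {q : G.PathGroup ⧸ G.vertSubgroup v // ∃ p, G.IsPath x₀ v p ∧ QuotientGroup.mk p = q}

/-- Edges of the Bass–Serre tree based at `x₀`: over the edge `e` of `X` lie the cosets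
`p · 𝒢_e`, where `p` is (the class of) a path from `x₀` to the origin of `e`. -/
def TreeEdge (G : GraphOfGroups.{u₁, u₂, u₃, u₄} X) (x₀ : V) : Type (max u₁ u₂ u₃) :=
  Σ e : E, {q : G.PathGroup ⧸ G.edgeSubgroup e //
    ∃ p, G.IsPath x₀ (X.src e) p ∧ QuotientGroup.mk p = q}

/-- The map `p · 𝒢_e ↦ p e · 𝒢_{t(e)}`. -/
def cosetTgt (G : GraphOfGroups.{u₁, u₂, u₃, u₄} X) (e : E) :
    G.PathGroup ⧸ G.edgeSubgroup e → G.PathGroup ⧸ G.vertSubgroup (X.tgt e) :=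
  Quotient.map' (fun p => p * G.ofEdge e) (by
    intro p q h
    rw [QuotientGroup.leftRel_apply] at h ⊢
    obtain ⟨g, hg⟩ := h
    refine ⟨G.toTgt e g, ?_⟩
    have h₁ := G.ofEdge_mul_toTgt e g
    have h₂ : G.ofVert _ (G.toSrc e g) = p⁻¹ * q := hg
    rw [h₂] at h₁
    rw [mul_inv_rev, mul_assoc, ← mul_assoc p⁻¹, ← h₁]
    group)

/-- The Bass–Serre tree of a graph of groups, based at `x₀`: the edge `p · 𝒢_e` leads from
`p · 𝒢_{o(e)}` to `p e · 𝒢_{t(e)}`. -/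
def tree (G : GraphOfGroups.{u₁, u₂, u₃, u₄} X) (x₀ : V) :
    OrGraph (G.TreeVert x₀) (G.TreeEdge x₀) where
  src ε := ⟨X.src ε.1, Subgroup.quotientMapOfLE (G.edgeSubgroup_le ε.1) ε.2.1, by
    obtain ⟨p, hp, h⟩ := ε.2.2
    exact ⟨p, hp, by rw [← h]; rfl⟩⟩
  tgt ε := ⟨X.tgt ε.1, G.cosetTgt ε.1 ε.2.1, by
    obtain ⟨p, hp, h⟩ := ε.2.2
    exact ⟨p * G.ofEdge ε.1, hp.mul (.edge ε.1), by rw [← h]; rfl⟩⟩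

/-- `π₁(𝒢, X, x₀)` acts on the vertices of the Bass–Serre tree by left multiplication. -/
instance (G : GraphOfGroups.{u₁, u₂, u₃, u₄} X) (x₀ : V) :
    MulAction (G.piOne x₀) (G.TreeVert x₀) where
  smul γ ν := ⟨ν.1, γ.1 • ν.2.1, by
    obtain ⟨p, hp, h⟩ := ν.2.2
    exact ⟨γ.1 * p, IsPath.mul γ.2 hp, by rw [← h]; rfl⟩⟩
  one_smul ν := Sigma.ext rfl (heq_of_eq (Subtype.ext (one_smul G.PathGroup ν.2.1)))
  mul_smul γ δ ν := Sigma.ext rfl (heq_of_eq (Subtype.ext (mul_smul γ.1 δ.1 ν.2.1)))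

/-- `π₁(𝒢, X, x₀)` acts on the edges of the Bass–Serre tree by left multiplication. -/
instance (G : GraphOfGroups.{u₁, u₂, u₃, u₄} X) (x₀ : V) :
    MulAction (G.piOne x₀) (G.TreeEdge x₀) where
  smul γ ε := ⟨ε.1, γ.1 • ε.2.1, by
    obtain ⟨p, hp, h⟩ := ε.2.2
    exact ⟨γ.1 * p, IsPath.mul γ.2 hp, by rw [← h]; rfl⟩⟩
  one_smul ε := Sigma.ext rfl (heq_of_eq (Subtype.ext (one_smul G.PathGroup ε.2.1)))
  mul_smul γ δ ε := Sigma.ext rfl (heq_of_eq (Subtype.ext (mul_smul γ.1 δ.1 ε.2.1)))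

/-- The bi-infinite sequence `α` of oriented edges is an axis of `R` in the Bass–Serre tree with
translation length `k`: an edge path through pairwise distinct vertices (in a tree: a bi-infinite
geodesic) that `R` maps to itself, as a translation by `k > 0` edges. Such an axis exists exactly
when `R` is hyperbolic, i.e. fixes no vertex, and it is then unique up to its parametrization. -/
structure IsAxis (G : GraphOfGroups.{u₁, u₂, u₃, u₄} X) (x₀ : V) (R : G.piOne x₀)
    (α : ℤ → G.TreeEdge x₀ × Bool) (k : ℕ) : Prop where
  pos : 0 < k
  chain : ∀ n, (G.tree x₀).ter (α n) = (G.tree x₀).ini (α (n + 1))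
  distinct : Function.Injective fun n => (G.tree x₀).ini (α n)
  shift : ∀ n, α (n + k) = (R • (α n).1, (α n).2)

open Classical in
/-- The `e`-length `ℓ_e(R)`, for an edge `e` of `X`: the number of edges of the quotient
of the axis of `R` by the translation `R` that lie over `e` (the edges of the tree over `e` form one
orbit of the fundamental group). It is `0` if `R` has no axis, i.e. is not hyperbolic. -/
noncomputable def eLength (G : GraphOfGroups.{u₁, u₂, u₃, u₄} X) (x₀ : V) (e : E)
    (R : G.piOne x₀) : ℕ :=
  if h : ∃ a : (ℤ → G.TreeEdge x₀ × Bool) × ℕ, G.IsAxis x₀ R a.1 a.2 then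
    ((Finset.range h.choose.2).filter fun i => (h.choose.1 (i : ℤ)).1.1 = e).card
  else 0

end BassSerreTree

end GraphOfGroups

/-! Since the group of `e` is trivial, `e` is a free letter in the presentation of F(𝒢, X), so a
homomorphism defined there may be given any value on `e`. The axis of `R` crosses `e`, hence `R` is
conjugate to a cyclic word in `e` and its inverse, with coefficients that are paths of X ∖ {e};
since the axis never backtracks, a coefficient between crossings in opposite directions is
nontrivial. Given an element of A killed in Γ/N(R), the limit group hypothesis supplies a map from Γ
to a free group F that keeps this element and all those coefficients nontrivial whenever they are
so. Sending `e` to a new letter `none` extends it to a map into F * ⟨none⟩, which takes `R` to a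
conjugate of a cyclically reduced word containing `none`. By the Freiheitssatz
(`FreeGroup.freiheitssatz`) F embeds in the resulting one-relator group, so the given element is
trivial in Γ. Finally A embeds in Γ by a retraction (`pathGroupMap_injective`).

The Freiheitssatz is proved by induction on length. If the omitted letter `t` has nonzero exponent
sum, the equation r = 1 can be solved for `t` over finite p-groups for large p, and free groups are
residually finite p-groups. If the sum is zero, Magnus rewriting gives a shorter relator, and an HNN
extension of its one-relator group recovers the original situation. -/

/-! ### Unitriangular matrices in characteristic p -/

section Unitriangular

variable {R : Type*} [CommRing R] {n : ℕ}

/-- The upper triangular matrices with ones on the diagonal. -/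
def Matrix.unitriangular (R : Type*) [CommRing R] (n : ℕ) :
    Submonoid (Matrix (Fin n) (Fin n) R) where
  carrier := {M | (∀ i j, j < i → M i j = 0) ∧ ∀ i, M i i = 1}
  one_mem' := ⟨fun i j h => Matrix.one_apply_ne h.ne', fun i => Matrix.one_apply_eq i⟩
  mul_mem' := by
    rintro A B ⟨hA, hA'⟩ ⟨hB, hB'⟩
    refine ⟨fun i j h => ?_, fun i => ?_⟩
    · rw [Matrix.mul_apply]
      refine Finset.sum_eq_zero fun k _ => ?_
      rcases lt_or_ge k i with hk | hk
      · rw [hA i k hk, zero_mul]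
      · rw [hB k j (h.trans_le hk), mul_zero]
    · rw [Matrix.mul_apply, Finset.sum_eq_single i, hA', hB', one_mul]
      · intro k _ hk
        rcases lt_or_gt_of_ne hk with hk | hk
        · rw [hA i k hk, zero_mul]
        · rw [hB k i hk, mul_zero]
      · simp

theorem Matrix.pow_apply_eq_zero_of_strictUpper {N : Matrix (Fin n) (Fin n) R}
    (hN : ∀ i j, j ≤ i → N i j = 0) (m : ℕ) (i j : Fin n) (h : (j : ℕ) < i + m) :
    (N ^ m) i j = 0 := by
  induction m generalizing j with
  | zero => exact Matrix.one_apply_ne (by rintro rfl; simp at h)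
  | succ m ih =>
    rw [pow_succ, Matrix.mul_apply]
    refine Finset.sum_eq_zero fun k _ => ?_
    rcases lt_or_ge (k : ℕ) (i + m) with hk | hk
    · rw [ih k hk, zero_mul]
    · rw [hN k j (by rw [Fin.le_def]; omega), mul_zero]

/-- In characteristic p, raising 1 + (M - 1) to the power p ^ n gives 1 + (M - 1) ^ p ^ n, and M - 1
is strictly upper triangular, so its n-th power already vanishes. -/
theorem Matrix.unitriangular_pow_prime_pow {p : ℕ} [Fact p.Prime] [CharP R p] (hn : 0 < n)
    {M : Matrix (Fin n) (Fin n) R} (hM : M ∈ Matrix.unitriangular R n) : M ^ p ^ n = 1 := by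
  have : Nonempty (Fin n) := ⟨⟨0, hn⟩⟩
  have hnil : (M - 1) ^ n = 0 := by
    ext i j
    refine Matrix.pow_apply_eq_zero_of_strictUpper (fun i j h => ?_) n i j (by omega)
    rcases h.lt_or_eq with h | rfl
    · rw [Matrix.sub_apply, hM.1 i j h, Matrix.one_apply_ne h.ne', sub_zero]
    · rw [Matrix.sub_apply, hM.2, Matrix.one_apply_eq, sub_self]
  have h := add_pow_char_pow_of_commute p n (Commute.one_left (M - 1))
  rwa [add_sub_cancel, one_pow,
    pow_eq_zero_of_le (Nat.lt_pow_self (Fact.out : p.Prime).one_lt).le hnil, add_zero] at h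

/-- The group of upper unitriangular matrices over a ring of prime characteristic. -/
def Matrix.unitriangularGroup (p : ℕ) [Fact p.Prime] (R : Type*) [CommRing R] [CharP R p] (n : ℕ)
    (hn : 0 < n) : Subgroup (Matrix (Fin n) (Fin n) R)ˣ where
  carrier := {u | (u : Matrix (Fin n) (Fin n) R) ∈ Matrix.unitriangular R n}
  one_mem' := one_mem (Matrix.unitriangular R n)
  mul_mem' := fun {u v} hu hv => (Matrix.unitriangular R n).mul_mem hu hv
  inv_mem' := by
    intro u hu
    -- Finite order makes the inverse a natural power of `u`, so closure under products suffices.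
    have h : u ^ p ^ n = 1 := Units.ext (by
      rw [Units.val_pow_eq_pow_val, Matrix.unitriangular_pow_prime_pow hn hu, Units.val_one])
    have h' : u⁻¹ = u ^ (p ^ n - 1) := by
      rw [inv_eq_iff_mul_eq_one, ← pow_succ',
        Nat.sub_add_cancel (Nat.one_le_pow _ _ (Fact.out : p.Prime).pos), h]
    rw [h', Set.mem_ofPred_eq, Units.val_pow_eq_pow_val]
    exact pow_mem hu _

theorem Matrix.isPGroup_unitriangularGroup (p : ℕ) [Fact p.Prime] [CharP R p] (hn : 0 < n) :
    IsPGroup p (Matrix.unitriangularGroup p R n hn) := fun u =>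
  ⟨n, Subtype.ext (Units.ext (by
    have h : ((u : (Matrix (Fin n) (Fin n) R)ˣ) : Matrix (Fin n) (Fin n) R) ∈
      Matrix.unitriangular R n := u.2
    simpa using Matrix.unitriangular_pow_prime_pow (p := p) hn h))⟩

/-- Entry (0, j) of a product of m bidiagonal matrices sums over paths from 0 to j rising by at most
one per factor. None reaches j > m, and exactly one reaches m, contributing the product of the
superdiagonal entries. -/
theorem Matrix.list_prod_apply_of_bidiagonal {k : ℕ}
    (l : List (Matrix (Fin (k + 1)) (Fin (k + 1)) R)) (hl : l.length ≤ k)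
    (h : ∀ A ∈ l, ∀ i j : Fin (k + 1), (i : ℕ) ≠ j → (i : ℕ) + 1 ≠ j → A i j = 0) (m : ℕ)
    (hm : m ≤ l.length) :
    (∀ j : Fin (k + 1), m < (j : ℕ) → (l.take m).prod 0 j = 0) ∧
    ((∀ (i : ℕ) (hi : i < l.length),
      IsUnit (l[i] ⟨i, by omega⟩ ⟨i + 1, by omega⟩)) →
      IsUnit ((l.take m).prod 0 ⟨m, by omega⟩)) := by
  induction m with
  | zero =>
    simp only [List.take_zero, List.prod_nil]
    refine ⟨fun j hj => Matrix.one_apply_ne (by rintro rfl; simp at hj), fun _ => ?_⟩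
    rw [show (⟨0, by omega⟩ : Fin (k + 1)) = 0 from rfl, Matrix.one_apply_eq]
    exact isUnit_one
  | succ m ih =>
    obtain ⟨ih₁, ih₂⟩ := ih (by omega)
    have hA := h _ (List.getElem_mem (show m < l.length by omega))
    rw [List.take_succ_eq_append_getElem (by omega), List.prod_append, List.prod_singleton]
    refine ⟨fun j hj => ?_, fun hu => ?_⟩
    · rw [Matrix.mul_apply]
      refine Finset.sum_eq_zero fun i _ => ?_
      rcases lt_or_ge m (i : ℕ) with hi | hi
      · rw [ih₁ i hi, zero_mul]
      · rw [hA i j (by omega) (by omega), mul_zero]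
    · rw [Matrix.mul_apply, Finset.sum_eq_single ⟨m, by omega⟩]
      · exact (ih₂ hu).mul (hu m (by omega))
      · intro i _ hi
        rcases lt_or_ge m (i : ℕ) with hi' | hi'
        · rw [ih₁ i hi', zero_mul]
        · have : (i : ℕ) ≠ m := fun h => hi (Fin.ext h)
          rw [hA i _ (by simp; omega) (by simp; omega), mul_zero]
      · simp

end Unitriangular

/-! ### The Freiheitssatz for nonzero exponent sum -/

namespace FreeGroup

variable {S : Type u}

/-- The exponent sum of the generator `t`. -/
noncomputable def expSum (t : S) : FreeGroup S →* Multiplicative ℤ :=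
  open Classical in lift fun s => if s = t then Multiplicative.ofAdd 1 else 1

/-- Each letter `t` or its inverse contributes one factor `z` or its inverse, and centrality gathers
them all on the right. -/
theorem lift_mul_central {P : Type*} [Group P] (f g : S → P) (t : S) {z : P}
    (hz : z ∈ Subgroup.center P) (hg : ∀ s, s ≠ t → g s = f s) (hgt : g t = f t * z)
    (w : FreeGroup S) : lift g w = lift f w * z ^ (expSum t w).toAdd := by
  have hc : ∀ (m : ℤ) (y : P), z ^ m * y = y * z ^ m := fun m y =>
    ((Subgroup.mem_center_iff.1 (zpow_mem hz m)) y).symm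
  let ψ : FreeGroup S →* P :=
    { toFun := fun w => lift f w * z ^ (expSum t w).toAdd
      map_one' := by simp
      map_mul' := fun x y => by
        rw [_root_.map_mul, _root_.map_mul, toAdd_mul, zpow_add, mul_assoc, mul_assoc,
          ← mul_assoc (z ^ _) (lift f y), hc _ (lift f y), mul_assoc] }
  have : lift g = ψ := by
    ext s
    by_cases h : s = t
    · subst h
      simp [ψ, expSum, hgt]
    · simp [ψ, expSum, hg s h, h]
  exact DFunLike.congr_fun this w

/-- Nonsingular equations over nilpotent `p`-groups have solutions. -/
theorem exists_lift_eq_one {p : ℕ} [Fact p.Prime] (t : S) (w : FreeGroup S)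
    (hw : ¬ (p : ℤ) ∣ (expSum t w).toAdd) (P : Type*) [Group P] [Group.IsNilpotent P]
    (hP : IsPGroup p P) (f : S → P) :
    ∃ g : S → P, (∀ s, s ≠ t → g s = f s) ∧ lift g w = 1 := by
  revert hP f
  -- Induct along P → P/Z(P). A solution modulo the center lifts to `f'` with central value on `w`;
  -- this defect is cancelled by a central correction of the value at `t`.
  refine Group.nilpotent_center_quotient_ind (P := fun P _ _ => IsPGroup p P → ∀ f : S → P,
    ∃ g : S → P, (∀ s, s ≠ t → g s = f s) ∧ lift g w = 1) P ?_ ?_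
  · intro P _ _ hP f
    exact ⟨f, fun _ _ => rfl, Subsingleton.elim _ _⟩
  · intro P _ _ ih hP f
    obtain ⟨g, hg, hgw⟩ := ih (hP.to_quotient _) (fun s => QuotientGroup.mk (f s))
    classical
    obtain ⟨y, hy⟩ := QuotientGroup.mk_surjective (g t)
    let f' : S → P := Function.update f t y
    have hf' : (QuotientGroup.mk' (Subgroup.center P)).comp (lift f') = lift g := by
      ext s
      by_cases h : s = t
      · subst h; simpa [f'] using hy
      · simp [f', h, hg s h]
    have hc : lift f' w ∈ Subgroup.center P := by
      rw [← QuotientGroup.eq_one_iff, ← hgw, ← hf']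
      rfl
    have hn : ¬ p ∣ (expSum t w).toAdd.natAbs := by rwa [← Int.natCast_dvd]
    -- The exponent sum is prime to p, so the corresponding power map is bijective on the p-group
    -- Z(P).
    obtain ⟨z, hz⟩ := ((hP.to_subgroup (Subgroup.center P)).powEquiv' hn).surjective ⟨_, hc⟩
    have hz' : (z : P) ^ (expSum t w).toAdd.natAbs = lift f' w := congrArg Subtype.val hz
    have key : ∀ ζ : P, ζ ∈ Subgroup.center P → lift f' w * ζ ^ (expSum t w).toAdd = 1 →
        ∃ g : S → P, (∀ s, s ≠ t → g s = f s) ∧ lift g w = 1 := fun ζ hζ h =>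
      ⟨Function.update f t (y * ζ), fun s hs => Function.update_of_ne hs _ _, by
        rw [lift_mul_central f' _ t hζ (fun s hs => by simp [f', hs]) (by simp [f']), h]⟩
    rcases Int.natAbs_eq (expSum t w).toAdd with h | h
    · refine key (z : P)⁻¹ (inv_mem z.2) ?_
      rw [h, zpow_natCast, inv_pow, hz', mul_inv_cancel]
    · refine key (z : P) z.2 ?_
      rw [h, zpow_neg, zpow_natCast, hz', mul_inv_cancel]

/-- Free groups are residually finite `p`-groups, for all large primes `p`. -/
theorem exists_finite_pGroup_ne_one (w : FreeGroup S) (hw : w ≠ 1) :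
    ∃ B : ℕ, ∀ (p : ℕ) [Fact p.Prime], B < p →
      ∃ (P : Type) (_ : Group P) (_ : Finite P) (f : FreeGroup S →* P), IsPGroup p P ∧ f w ≠ 1 := by
  classical
  -- The syllables of w = s₁^m₁ ⋯ s_k^m_k: neighbouring sᵢ are distinct and each mᵢ is nonzero.
  let W := Monoid.CoprodI.Word.equiv (freeGroupEquivCoprodI w)
  have hWprod : W.prod = freeGroupEquivCoprodI w := Monoid.CoprodI.Word.equiv.symm_apply_apply _
  set l := W.toList
  let ex : FreeGroup Unit → ℤ := freeGroupUnitEquivInt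
  have hex : ∀ m, of () ^ ex m = m := freeGroupUnitEquivInt.symm_apply_apply
  -- A prime above the sum of the |mᵢ| divides no mᵢ.
  refine ⟨(l.map fun x => (ex x.2).natAbs).sum, fun p _ hp => ?_⟩
  let k := l.length
  -- `N s` marks the superdiagonal places of the syllables in `s`. No two marks are adjacent, so `N
  -- s` squares to zero and (1 + N s) ^ m = 1 + m N s; the corner entry of the image of `w` is then
  -- the product of the mᵢ modulo p.
  let N : S → Matrix (Fin (k + 1)) (Fin (k + 1)) (ZMod p) := fun s =>
    Matrix.of fun i j => if (j : ℕ) = i + 1 ∧ l[(i : ℕ)]?.map Sigma.fst = some s then 1 else 0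
  have hN0 : ∀ s (i j : Fin (k + 1)), (j : ℕ) ≠ i + 1 → N s i j = 0 := fun s i j h => by simp [N, h]
  have hN : ∀ s, N s * N s = 0 := by
    intro s
    ext i j
    rw [Matrix.mul_apply]
    refine Finset.sum_eq_zero fun m _ => ?_
    by_cases h₁ : (m : ℕ) = i + 1
    swap
    · rw [hN0 s i m h₁, zero_mul]
    by_cases h₂ : (j : ℕ) = m + 1
    swap
    · rw [hN0 s m j h₂, mul_zero]
    have hi : (i : ℕ) + 1 < l.length := by have := j.2; omega
    have hne : l[(i : ℕ)].1 ≠ l[(i : ℕ) + 1].1 :=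
      List.isChain_iff_getElem.1 W.chain_ne i hi
    simp only [N, Matrix.of_apply, h₁, h₂, true_and, List.getElem?_eq_getElem hi,
      List.getElem?_eq_getElem (show (i : ℕ) < l.length by omega), Option.map_some,
      Option.some.injEq]
    by_cases h₃ : l[(i : ℕ)].1 = s
    · have h₄ : l[(i : ℕ) + 1].1 ≠ s := fun h => hne (h₃.trans h.symm)
      rw [if_neg h₄, mul_zero]
    · rw [if_neg h₃, zero_mul]
  let u : S → (Matrix (Fin (k + 1)) (Fin (k + 1)) (ZMod p))ˣ := fun s =>
    ⟨1 + N s, 1 - N s, by rw [mul_sub, add_mul, add_mul, hN]; simp,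
      by rw [sub_mul, mul_add, mul_add, hN]; simp⟩
  have hu : ∀ s (m : ℤ), ((u s ^ m : (Matrix (Fin (k + 1)) (Fin (k + 1)) (ZMod p))ˣ) :
      Matrix (Fin (k + 1)) (Fin (k + 1)) (ZMod p)) = 1 + m • N s := by
    intro s m
    induction m with
    | zero => simp
    | succ m ih =>
      rw [zpow_add_one, Units.val_mul, ih]
      simp only [u, mul_add, add_mul, smul_mul_assoc, hN, add_smul]
      simp [add_assoc]
    | pred m ih =>
      rw [zpow_sub_one, Units.val_mul, ih]
      have : ((u s)⁻¹ : (Matrix (Fin (k + 1)) (Fin (k + 1)) (ZMod p))ˣ).val = 1 - N s := rfl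
      rw [this]
      simp only [mul_sub, add_mul, smul_mul_assoc, hN, sub_smul]
      simp [sub_eq_add_neg, add_assoc]
  have hmem : ∀ s, u s ∈ Matrix.unitriangularGroup p (ZMod p) (k + 1) (Nat.succ_pos k) := by
    intro s
    change _ ∧ _
    refine ⟨fun i j h => ?_, fun i => ?_⟩
    · change (1 + N s) i j = 0
      rw [Matrix.add_apply, hN0 s i j (by rw [Fin.lt_def] at h; omega), Matrix.one_apply_ne h.ne',
        add_zero]
    · change (1 + N s) i i = 1
      rw [Matrix.add_apply, hN0 s i i (by omega), Matrix.one_apply_eq, add_zero]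
  let f : FreeGroup S →* Matrix.unitriangularGroup p (ZMod p) (k + 1) (Nat.succ_pos k) :=
    lift fun s => ⟨u s, hmem s⟩
  refine ⟨_, inferInstance, inferInstance, f, Matrix.isPGroup_unitriangularGroup p _, fun hf => ?_⟩
  let F : FreeGroup S →* Matrix (Fin (k + 1)) (Fin (k + 1)) (ZMod p) :=
    (Units.coeHom _).comp (lift u)
  have hF : F w = 1 := by
    have h : (Subgroup.subtype _).comp f = lift u := by ext s : 1; simp [f]
    change ((lift u w : (Matrix (Fin (k + 1)) (Fin (k + 1)) (ZMod p))ˣ) :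
      Matrix (Fin (k + 1)) (Fin (k + 1)) (ZMod p)) = 1
    rw [← h, MonoidHom.comp_apply, hf, _root_.map_one, Units.val_one]
  let F' : Monoid.CoprodI (fun _ : S => FreeGroup Unit) →*
      Matrix (Fin (k + 1)) (Fin (k + 1)) (ZMod p) :=
    Monoid.CoprodI.lift fun s => (Units.coeHom _).comp (lift fun _ => u s)
  have hFF' : F'.comp (freeGroupEquivCoprodI (ι := S)).toMonoidHom = F := by
    ext s : 1
    simp [F', F]
  have hval : ∀ (s : S) (m : FreeGroup Unit), F' (Monoid.CoprodI.of (i := s) m) = 1 + ex m • N s := by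
    intro s m
    rw [← hu]
    conv_lhs => rw [← hex m]
    change (Monoid.CoprodI.lift _) _ = _
    rw [Monoid.CoprodI.lift_of, MonoidHom.comp_apply, map_zpow, lift_apply_of]
    rfl
  let A : List (Matrix (Fin (k + 1)) (Fin (k + 1)) (ZMod p)) :=
    l.map fun x => 1 + ex x.2 • N x.1
  have hA : A.prod = 1 := by
    rw [← hF, ← hFF', MonoidHom.comp_apply]
    change _ = F' (freeGroupEquivCoprodI w)
    rw [← hWprod, Monoid.CoprodI.Word.prod, map_list_prod, List.map_map]
    refine congrArg List.prod (List.map_congr_left fun x _ => ?_)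
    exact (hval x.1 x.2).symm
  have hlen : A.length = k := List.length_map ..
  have hbid : ∀ M ∈ A, ∀ i j : Fin (k + 1), (i : ℕ) ≠ j → (i : ℕ) + 1 ≠ j → M i j = 0 := by
    intro M hM i j h₁ h₂
    obtain ⟨x, -, rfl⟩ := List.mem_map.1 hM
    rw [Matrix.add_apply, Matrix.smul_apply, hN0 _ i j h₂.symm,
      Matrix.one_apply_ne (fun h => h₁ (congrArg Fin.val h)), smul_zero, add_zero]
  have hunit : ∀ (i : ℕ) (hi : i < A.length),
      IsUnit (A[i] ⟨i, by omega⟩ ⟨i + 1, by omega⟩) := by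
    intro i hi
    have hi' : i < l.length := by omega
    have hAi : A[i] = 1 + ex l[i].2 • N l[i].1 := List.getElem_map ..
    have hNi : N l[i].1 ⟨i, by omega⟩ ⟨i + 1, by omega⟩ = 1 := by
      simp only [N, Matrix.of_apply, List.getElem?_eq_getElem hi', Option.map_some, and_self, if_true]
    rw [hAi, Matrix.add_apply, Matrix.smul_apply, hNi,
      Matrix.one_apply_ne (by intro h; simp at h), zero_add,
      isUnit_iff_ne_zero, zsmul_eq_mul, mul_one, Ne, ZMod.intCast_zmod_eq_zero_iff_dvd]
    intro hdvd
    have hne : l[i].2 ≠ 1 := W.ne_one _ (List.getElem_mem hi')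
    have hexne : ex l[i].2 ≠ 0 := fun h => hne (by rw [← hex l[i].2, h, zpow_zero])
    have h₁ : p ≤ (ex l[i].2).natAbs :=
      Nat.le_of_dvd (Int.natAbs_pos.2 hexne) (Int.natCast_dvd.1 hdvd)
    have h₂ : (ex l[i].2).natAbs ≤ (l.map fun x => (ex x.2).natAbs).sum :=
      List.le_sum_of_mem (List.mem_map.2 ⟨_, List.getElem_mem hi', rfl⟩)
    omega
  have hfin := (Matrix.list_prod_apply_of_bidiagonal A hlen.le hbid k hlen.ge).2 hunit
  rw [List.take_of_length_le hlen.le, hA] at hfin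
  have hk : k ≠ 0 := by
    intro hk
    have hnil : W.toList = [] := List.length_eq_zero_iff.1 hk
    apply hw
    apply (freeGroupEquivCoprodI (ι := S)).injective
    rw [_root_.map_one, ← hWprod, Monoid.CoprodI.Word.prod, hnil]
    rfl
  rw [Matrix.one_apply_ne (by intro h; exact hk (congrArg Fin.val h).symm)] at hfin
  exact not_isUnit_zero hfin

/-- The Freiheitssatz in the case of a nonzero exponent sum. -/
theorem eq_one_of_mem_normalClosure_of_expSum_ne_zero (t : S) (r : FreeGroup S)
    (hr : (expSum t r).toAdd ≠ 0) (a : FreeGroup {s // s ≠ t})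
    (ha : map Subtype.val a ∈ Subgroup.normalClosure {r}) : a = 1 := by
  by_contra hne
  have hinj : Function.Injective (map (Subtype.val : {s // s ≠ t} → S)) :=
    map_injective Subtype.val_injective
  obtain ⟨B, hB⟩ := exists_finite_pGroup_ne_one (map Subtype.val a)
    (fun h => hne (hinj (h.trans (map_one _).symm)))
  obtain ⟨p, hp, hprime⟩ := Nat.exists_infinite_primes (B + (expSum t r).toAdd.natAbs + 1)
  have : Fact p.Prime := ⟨hprime⟩
  obtain ⟨P, _, _, f, hP, hfa⟩ := hB p (by omega)
  have := hP.isNilpotent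
  -- The prime was chosen above the absolute value of the exponent sum as well.
  have hdvd : ¬ (p : ℤ) ∣ (expSum t r).toAdd := fun h => by
    have := Nat.le_of_dvd (Int.natAbs_pos.2 hr) (Int.natCast_dvd.1 h)
    omega
  -- Altering `f` only at `t` kills `r` but leaves the image of `a` unchanged, hence nontrivial.
  obtain ⟨g, hg, hgr⟩ := exists_lift_eq_one t r hdvd P hP fun s => f (of s)
  have h₁ : lift g (map Subtype.val a) = 1 := by
    have : Subgroup.normalClosure {r} ≤ (lift g).ker :=
      Subgroup.normalClosure_le_normal (Set.singleton_subset_iff.2 hgr)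
    exact this ha
  have h₂ : (lift g).comp (map (Subtype.val : {s // s ≠ t} → S)) =
      f.comp (map Subtype.val) := by
    ext s
    simp [hg s.1 s.2]
  exact hfa ((DFunLike.congr_fun h₂ a).symm.trans h₁)

end FreeGroup

namespace FreeGroup

variable {S : Type u}

theorem hom_eq_on_mk {H : Type*} [Group H] (f g : FreeGroup S →* H) (L : List (S × Bool))
    (h : ∀ s ∈ L.map Prod.fst, f (of s) = g (of s)) : f (mk L) = g (mk L) := by
  induction L with
  | nil => exact (_root_.map_one f).trans (_root_.map_one g).symm
  | cons x L ih =>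
    obtain ⟨s, b⟩ := x
    have hs : f (of s) = g (of s) := h s (by simp)
    have hx : mk ((s, b) :: L) = mk [(s, b)] * mk L := by rw [mul_mk]; rfl
    have hb : f (mk [(s, b)]) = g (mk [(s, b)]) := by
      cases b
      · have : (mk [(s, false)] : FreeGroup S) = (of s)⁻¹ := rfl
        rw [this, _root_.map_inv, _root_.map_inv, hs]
      · exact hs
    rw [hx, _root_.map_mul, _root_.map_mul, hb, ih fun s' hs' => h s' (by simp [hs'])]

/-! ### Cyclically reduced words and conjugation -/

section CyclicReduction

/-- A cyclically reduced word that contains `t` is not conjugate to a word without `t`. -/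
theorem IsCyclicallyReduced.mk_ne_conj {L : List (S × Bool)} (hL : IsCyclicallyReduced L) {t : S}
    (ht : t ∈ L.map Prod.fst) (g : FreeGroup S) (h : FreeGroup {s // s ≠ t}) :
    mk L ≠ g * map Subtype.val h * g⁻¹ := by
  classical
  intro heq
  -- Count occurrences of `t` and its inverse in n-th powers: there are at least n on the left,
  -- while on the right the n-th power is still a conjugate by `g`, with at most c g + c g⁻¹ of
  -- them.
  let c : FreeGroup S → ℕ := fun x => x.toWord.countP fun y => y.1 = t
  have hmul : ∀ x y, c (x * y) ≤ c x + c y := fun x y => by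
    rw [← List.countP_append]
    exact (toWord_mul_sublist x y).countP_le
  have hmap : ∀ y : FreeGroup {s // s ≠ t}, c (map Subtype.val y) = 0 := by
    intro y
    rw [← mk_toWord (x := y), map.mk]
    refine Nat.le_zero.1 ((reduce.red.sublist.countP_le).trans (Nat.le_zero.2 ?_))
    rw [List.countP_eq_zero]
    intro z hz
    obtain ⟨x, -, rfl⟩ := List.mem_map.1 hz
    simpa using x.1.2
  have hpow : ∀ n : ℕ, n ≤ c (mk L ^ n) := by
    intro n
    have h₁ : (mk L ^ n).toWord = (List.replicate n L).flatten := by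
      rw [pow_mk, toWord_mk, (hL.flatten_replicate n).isReduced.reduce_eq]
    have h₂ : 0 < L.countP fun y => y.1 = t := by
      obtain ⟨x, hx, hxt⟩ := List.mem_map.1 ht
      exact List.countP_pos_iff.2 ⟨x, hx, by simpa using hxt⟩
    change n ≤ List.countP _ _
    rw [h₁, List.countP_flatten, List.map_replicate, List.sum_replicate, smul_eq_mul]
    exact Nat.le_mul_of_pos_right n h₂
  have h₁ := hpow (c g + c g⁻¹ + 1)
  rw [heq, conj_pow, ← map_pow] at h₁
  have h₂ := hmul (g * map Subtype.val (h ^ (c g + c g⁻¹ + 1))) g⁻¹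
  have h₃ := hmul g (map Subtype.val (h ^ (c g + c g⁻¹ + 1)))
  rw [hmap] at h₃
  omega

theorem exists_conj_isCyclicallyReduced (L : List (S × Bool)) :
    ∃ (L' : List (S × Bool)) (g : FreeGroup S), IsCyclicallyReduced L' ∧
      L'.length ≤ L.length ∧ mk L = g * mk L' * g⁻¹ := by
  classical
  have h := reduceCyclically.conj_conjugator_reduceCyclically (reduce L)
  refine ⟨reduceCyclically (reduce L), mk (reduceCyclically.conjugator (reduce L)),
    reduceCyclically.isCyclicallyReduced (isReduced_iff_reduce_eq.2 reduce.idem), ?_, ?_⟩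
  · refine le_trans ?_ reduce.red.length_le
    have := congrArg List.length h
    simp only [List.length_append] at this
    omega
  · rw [inv_mk, mul_mk, mul_mk, h, reduce.self]

end CyclicReduction

/-! ### Magnus rewriting -/

section Rewriting

variable (t : S)

open Classical in
/-- Rewrite a word in terms of the conjugates `t ^ j * s * t ^ (-j)`, starting at height `j`. -/
noncomputable def rewriteConj : ℤ → List (S × Bool) → List (({s // s ≠ t} × ℤ) × Bool)
  | _, [] => []
  | j, (s, b) :: L =>
    if h : s = t then rewriteConj (if b then j + 1 else j - 1) L
    else ((⟨s, h⟩, j), b) :: rewriteConj j L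

/-- The homomorphism that sends the letter `(s, j)` to `t ^ j * s * t ^ (-j)`. -/
def conjHom : FreeGroup ({s // s ≠ t} × ℤ) →* FreeGroup S :=
  lift fun q => of t ^ q.2 * of q.1.1 * of t ^ (-q.2)

theorem rewriteConj_length_le (j : ℤ) (L : List (S × Bool)) :
    (rewriteConj t j L).length ≤ L.length := by
  induction L generalizing j with
  | nil => simp [rewriteConj]
  | cons x L ih =>
    obtain ⟨s, b⟩ := x
    rw [rewriteConj]
    split_ifs with h hb
    · exact (ih _).trans (Nat.le_succ _)
    · exact (ih _).trans (Nat.le_succ _)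
    · exact Nat.succ_le_succ (ih _)

/-- Letters `t` are absorbed into the heights; this strict drop drives the induction in the
Freiheitssatz. -/
theorem rewriteConj_length_lt (j : ℤ) (L : List (S × Bool)) (ht : t ∈ L.map Prod.fst) :
    (rewriteConj t j L).length < L.length := by
  induction L generalizing j with
  | nil => simp at ht
  | cons x L ih =>
    obtain ⟨s, b⟩ := x
    rw [rewriteConj]
    split_ifs with h hb
    · exact Nat.lt_succ_of_le (rewriteConj_length_le t _ L)
    · exact Nat.lt_succ_of_le (rewriteConj_length_le t _ L)
    · refine Nat.succ_lt_succ (ih _ ?_)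
      simpa [Ne.symm h] using ht

/-- The power of `t` on the right undoes the final height. Starting at height 0 with exponent sum 0,
both outer powers vanish and the rewritten word represents the original element. -/
theorem conjHom_rewriteConj (j : ℤ) (L : List (S × Bool)) :
    conjHom t (mk (rewriteConj t j L)) =
      of t ^ j * mk L * of t ^ (-(j + (expSum t (mk L)).toAdd)) := by
  induction L generalizing j with
  | nil =>
    have h : (mk [] : FreeGroup S) = 1 := rfl
    have h' : (mk [] : FreeGroup ({s // s ≠ t} × ℤ)) = 1 := rfl
    simp [rewriteConj, h, h']
  | cons x L ih =>
    obtain ⟨s, b⟩ := x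
    have hx : mk ((s, b) :: L) = mk [(s, b)] * mk L := by rw [mul_mk]; rfl
    have hf : ∀ {T : Type u} (y : T), (mk [(y, false)] : FreeGroup T) = (of y)⁻¹ := fun _ => rfl
    have ht' : ∀ {T : Type u} (y : T), (mk [(y, true)] : FreeGroup T) = of y := fun _ => rfl
    rw [rewriteConj, hx, _root_.map_mul, toAdd_mul]
    by_cases h : s = t
    · subst h
      rw [dif_pos rfl, ih]
      cases b
      · rw [hf, _root_.map_inv, toAdd_inv]
        have : expSum s (of s) = Multiplicative.ofAdd 1 := by simp [expSum]
        rw [this, toAdd_ofAdd, if_neg (by simp), zpow_sub_one]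
        simp only [mul_assoc]
        congr 4
        ring
      · rw [ht']
        have : expSum s (of s) = Multiplicative.ofAdd 1 := by simp [expSum]
        rw [this, toAdd_ofAdd, if_pos rfl, zpow_add_one]
        simp only [mul_assoc]
        congr 4
        ring
    · rw [dif_neg h]
      have hx' : mk (((⟨s, h⟩, j), b) :: rewriteConj t j L) =
        mk [((⟨s, h⟩, j), b)] * mk (rewriteConj t j L) := by rw [mul_mk]; rfl
      have hs : expSum t (of s) = 1 := by simp [expSum, h]
      rw [hx', _root_.map_mul, ih]
      cases b
      · rw [hf, hf, _root_.map_inv, _root_.map_inv, hs]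
        simp only [conjHom, lift_apply_of, inv_one, toAdd_one, zero_add]
        group
      · rw [ht', ht', hs]
        simp only [conjHom, lift_apply_of, toAdd_one, zero_add]
        group

end Rewriting

/-! ### The HNN extension that restores the letter `t` -/

section StableLetter

theorem mk_comp_map_injective {T D : Type*} (r : FreeGroup T) (q₀ : T)
    (hr : ∀ a : FreeGroup {q // q ≠ q₀}, map Subtype.val a ∈ Subgroup.normalClosure {r} → a = 1)
    (j : D → T) (hj : Function.Injective j) (hq : ∀ d, j d ≠ q₀) :
    Function.Injective ((QuotientGroup.mk' (Subgroup.normalClosure {r})).comp (map j)) := by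
  rw [injective_iff_map_eq_one]
  intro d hd
  let j' : D → {q // q ≠ q₀} := fun d => ⟨j d, hq d⟩
  have hj' : Function.Injective j' := fun x y h => hj (congrArg Subtype.val h)
  have h₁ : map Subtype.val (map j' d) = map j d := by rw [map.comp]; rfl
  have h₂ : map j' d = 1 := hr _ (by rw [h₁]; exact (QuotientGroup.eq_one_iff _).1 hd)
  exact map_injective hj' (h₂.trans (_root_.map_one _).symm)

/-- If the two Magnus subgroups of the one-relator group `⟨ (s, j) | L ⟩` are free, then they are
the associated subgroups of an HNN extension whose stable letter acts as a shift. -/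
theorem exists_hom_of_magnus_subgroups (t : S) (L : List (({s // s ≠ t} × ℤ) × Bool)) (m M : ℤ)
    (hmM : m < M) (hL : ∀ q ∈ L.map Prod.fst, m ≤ q.2 ∧ q.2 ≤ M) (x y : {s // s ≠ t})
    (hx : ∀ a : FreeGroup {q // q ≠ (x, M)},
      map Subtype.val a ∈ Subgroup.normalClosure {mk L} → a = 1)
    (hy : ∀ a : FreeGroup {q // q ≠ (y, m)},
      map Subtype.val a ∈ Subgroup.normalClosure {mk L} → a = 1) :
    ∃ (K : Type u) (_ : Group K) (f : FreeGroup S →* K), f (conjHom t (mk L)) = 1 ∧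
      Function.Injective (f.comp (map (Subtype.val : {s // s ≠ t} → S))) := by
  classical
  -- The letters of `D` avoid (x, M) and their shifts avoid (y, m), so both families are free in the
  -- base by `hx` and `hy`. Letters at heights outside [m, M] do not occur in the relator and do no
  -- harm.
  let D := {q : {s // s ≠ t} × ℤ // m ≤ q.2 ∧ q.2 < M}
  let π := QuotientGroup.mk' (Subgroup.normalClosure {mk L})
  let i₁ := π.comp (map (Subtype.val : D → _))
  let i₂ := π.comp (map fun q : D => (q.1.1, q.1.2 + 1))
  have h₁ : Function.Injective i₁ := mk_comp_map_injective (mk L) (x, M) hx _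
    Subtype.val_injective fun d h => by
      have := d.2.2
      rw [h] at this
      exact lt_irrefl _ this
  have h₂ : Function.Injective i₂ := mk_comp_map_injective (mk L) (y, m) hy _
    (fun a b h => by
      have h' := Prod.ext_iff.1 h
      exact Subtype.ext (Prod.ext h'.1 (add_right_cancel h'.2)))
    fun d h => by
      have h₁ : d.1.2 + 1 = m := congrArg Prod.snd h
      have := d.2.1
      omega
  let φ : i₁.range ≃* i₂.range := (MonoidHom.ofInjective h₁).symm.trans (MonoidHom.ofInjective h₂)
  let K := HNNExtension _ i₁.range i₂.range φ
  let τ : K := HNNExtension.t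
  let ι : _ →* K := HNNExtension.of
  have hshift : ∀ (s : {s // s ≠ t}) (j : ℤ), m ≤ j → j < M →
      ι (π (of (s, j + 1))) = τ * ι (π (of (s, j))) * τ⁻¹ := by
    intro s j hm hM
    have h := HNNExtension.equiv_eq_conj (φ := φ)
      ((MonoidHom.ofInjective h₁) (of ⟨(s, j), hm, hM⟩))
    have h' : φ ((MonoidHom.ofInjective h₁) (of ⟨(s, j), hm, hM⟩)) =
        MonoidHom.ofInjective h₂ (of ⟨(s, j), hm, hM⟩) := by
      simp [φ]
    rw [h'] at h
    simpa [MonoidHom.ofInjective_apply, i₁, i₂] using h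
  have hshift' : ∀ (s : {s // s ≠ t}) (k : ℕ), m + k ≤ M →
      ι (π (of (s, m + k))) = τ ^ (k : ℤ) * ι (π (of (s, m))) * τ ^ (-(k : ℤ)) := by
    intro s k
    induction k with
    | zero => intro _; simp
    | succ k ih =>
      intro hk
      push_cast at hk ⊢
      rw [← add_assoc, hshift s (m + k) (by omega) (by omega), ih (by omega)]
      group
  -- The conjugation by τ ^ (-m) is chosen so that `conjHom` followed by `f` sends (s, j) to its own
  -- image in the base whenever m ≤ j ≤ M.
  let f : FreeGroup S →* K := lift fun s =>
    if h : s = t then τ else τ ^ (-m) * ι (π (of (⟨s, h⟩, m))) * τ ^ m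
  have hft : f (of t) = τ := by simp [f]
  have hfs : ∀ s : {s // s ≠ t}, f (of s.1) = τ ^ (-m) * ι (π (of (s, m))) * τ ^ m := fun s => by
    simp [f, s.2]
  refine ⟨K, inferInstance, f, ?_, ?_⟩
  · have h : (f.comp (conjHom t)) (mk L) = (ι.comp π) (mk L) := by
      refine hom_eq_on_mk _ _ L fun q hq => ?_
      obtain ⟨s, j⟩ := q
      obtain ⟨hj₁, hj₂⟩ := hL _ hq
      obtain ⟨k, rfl⟩ := Int.le.dest hj₁
      rw [MonoidHom.comp_apply, MonoidHom.comp_apply, hshift' s k hj₂, conjHom, lift_apply_of,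
        _root_.map_mul, _root_.map_mul, map_zpow, map_zpow, hft, hfs]
      group
    have hπ : π (mk L) = 1 :=
      (QuotientGroup.eq_one_iff _).2 (Subgroup.subset_normalClosure (Set.mem_singleton _))
    rw [MonoidHom.comp_apply, MonoidHom.comp_apply, hπ, _root_.map_one] at h
    exact h
  -- As m < M, the letters of height m all avoid (x, M).
  · have hinj : Function.Injective (π.comp (map fun s : {s // s ≠ t} => (s, m))) :=
      mk_comp_map_injective (mk L) (x, M) hx _ (fun a b h => congrArg Prod.fst h)
        fun d h => hmM.ne (congrArg Prod.snd h)
    have hconj : f.comp (map (Subtype.val : {s // s ≠ t} → S)) =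
        (MulAut.conj (τ ^ (-m))).toMonoidHom.comp
          (ι.comp (π.comp (map fun s : {s // s ≠ t} => (s, m)))) := by
      ext s
      simp only [MonoidHom.comp_apply, map.of, hfs, MulEquiv.toMonoidHom_eq_coe, MonoidHom.coe_coe,
        MulAut.conj_apply, zpow_neg]
      exact congrArg _ (inv_inv (τ ^ m)).symm
    rw [hconj]
    exact (MulAut.conj (τ ^ (-m))).injective.comp ((HNNExtension.of_injective φ).comp hinj)

end StableLetter

/-- Magnus' **Freiheitssatz**: if the cyclically reduced word `L` contains the letter `t`, then the
other letters freely generate a subgroup of the one-relator group defined by `L`. -/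
theorem freiheitssatz (L : List (S × Bool)) (hL : IsCyclicallyReduced L) (t : S)
    (ht : t ∈ L.map Prod.fst) (a : FreeGroup {s // s ≠ t})
    (ha : map Subtype.val a ∈ Subgroup.normalClosure {mk L}) : a = 1 := by
  obtain ⟨n, hn⟩ : ∃ n, L.length = n := ⟨_, rfl⟩
  induction n using Nat.strong_induction_on generalizing S with
  | _ n ih =>
  by_cases hsum : (expSum t (mk L)).toAdd = 0
  swap
  · exact eq_one_of_mem_normalClosure_of_expSum_ne_zero t (mk L) hsum a ha
  obtain ⟨L', g, hL', hlen, hg⟩ := exists_conj_isCyclicallyReduced (rewriteConj t 0 L)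
  have hlt : L'.length < n := hn ▸ hlen.trans_lt (rewriteConj_length_lt t 0 L ht)
  have hconj : mk L = conjHom t g * conjHom t (mk L') * (conjHom t g)⁻¹ := by
    have h := conjHom_rewriteConj t 0 L
    rw [hsum, hg] at h
    simpa using h.symm
  -- Were all letters of `L'` at one height, `L` would be conjugate to a word without `t`, contrary
  -- to `IsCyclicallyReduced.mk_ne_conj`.
  have hindex : ∀ j : ℤ, ∃ q ∈ L'.map Prod.fst, q.2 ≠ j := by
    intro j
    by_contra! hj
    refine hL.mk_ne_conj ht (conjHom t g * of t ^ j) (lift (fun q => of q.1) (mk L')) ?_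
    have h : conjHom t (mk L') = ((MulAut.conj (of t ^ j)).toMonoidHom.comp
        ((map Subtype.val).comp (lift fun q => of q.1))) (mk L') := by
      refine hom_eq_on_mk _ _ L' fun q hq => ?_
      simp only [conjHom, hj q hq, lift_apply_of, MonoidHom.comp_apply, map.of,
        MulEquiv.toMonoidHom_eq_coe, MonoidHom.coe_coe, MulAut.conj_apply, zpow_neg]
    rw [hconj, h]
    simp only [MonoidHom.comp_apply, MulEquiv.toMonoidHom_eq_coe, MonoidHom.coe_coe,
      MulAut.conj_apply, mul_inv_rev, mul_assoc]
  let I := (L'.map fun z => z.1.2).toFinset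
  have hI : ∀ q ∈ L'.map Prod.fst, q.2 ∈ I := by
    intro q hq
    obtain ⟨z, hz, rfl⟩ := List.mem_map.1 hq
    exact List.mem_toFinset.2 (List.mem_map.2 ⟨z, hz, rfl⟩)
  have hI' : ∀ j ∈ I, ∃ x, (x, j) ∈ L'.map Prod.fst := by
    intro j hj
    obtain ⟨z, hz, rfl⟩ := List.mem_map.1 (List.mem_toFinset.1 hj)
    exact ⟨z.1.1, List.mem_map.2 ⟨z, hz, rfl⟩⟩
  have hne : I.Nonempty := by
    obtain ⟨q, hq, -⟩ := hindex 0
    exact ⟨q.2, hI q hq⟩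
  obtain ⟨x, hx⟩ := hI' _ (I.max'_mem hne)
  obtain ⟨y, hy⟩ := hI' _ (I.min'_mem hne)
  have hmM : I.min' hne < I.max' hne := by
    obtain ⟨q, hq, hqne⟩ := hindex (I.min' hne)
    exact (lt_of_le_of_ne (I.min'_le _ (hI q hq)) hqne.symm).trans_le (I.le_max' _ (hI q hq))
  -- Letters of extreme height occur in the shorter word `L'`, so the induction hypothesis may omit
  -- either (x, max) or (y, min).
  obtain ⟨K, _, f, hf, hinj⟩ := exists_hom_of_magnus_subgroups t L' (I.min' hne) (I.max' hne) hmM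
    (fun q hq => ⟨I.min'_le _ (hI q hq), I.le_max' _ (hI q hq)⟩) x y
    (fun b hb => ih _ hlt L' hL' _ hx b hb rfl) (fun b hb => ih _ hlt L' hL' _ hy b hb rfl)
  have hker : Subgroup.normalClosure {mk L} ≤ f.ker := by
    refine Subgroup.normalClosure_le_normal (Set.singleton_subset_iff.2 ?_)
    rw [SetLike.mem_coe, MonoidHom.mem_ker, hconj, _root_.map_mul, _root_.map_mul, hf, _root_.map_inv,
      mul_one, mul_inv_cancel]
  exact hinj ((hker ha).trans (_root_.map_one _).symm)

end FreeGroup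

/-! ### Homomorphisms out of F(𝒢, X) -/

namespace GraphOfGroups

variable {V : Type u₁} {E : Type u₂} {X : OrGraph V E}

section UniversalProperty

variable (G : GraphOfGroups.{u₁, u₂, u₃, u₄} X) {H : Type*} [Group H]

/-- The universal property of `F(𝒢, X)`. -/
def pathGroupLift (fv : ∀ v, G.vGrp v →* H) (fe : E → H)
    (h : ∀ f g, fe f * fv _ (G.toTgt f g) * (fe f)⁻¹ = fv _ (G.toSrc f g)) :
    G.PathGroup →* H :=
  QuotientGroup.lift (Subgroup.normalClosure G.relators)
    (Monoid.Coprod.lift (Monoid.CoprodI.lift fv) (FreeGroup.lift fe)) (by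
      intro x hx
      refine (Subgroup.normalClosure_le_normal (N := MonoidHom.ker _) ?_) hx
      rintro _ ⟨f, g, rfl⟩
      rw [SetLike.mem_coe, MonoidHom.mem_ker, map_mul, map_mul, map_mul, map_inv, map_inv,
        Monoid.Coprod.lift_apply_inl, Monoid.Coprod.lift_apply_inl, Monoid.Coprod.lift_apply_inr,
        Monoid.CoprodI.lift_of, Monoid.CoprodI.lift_of, FreeGroup.lift_apply_of, mul_inv_eq_one]
      exact h f g)

theorem pathGroupLift_ofVert (fv : ∀ v, G.vGrp v →* H) (fe : E → H)
    (h : ∀ f g, fe f * fv _ (G.toTgt f g) * (fe f)⁻¹ = fv _ (G.toSrc f g)) (v : V)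
    (g : G.vGrp v) : G.pathGroupLift fv fe h (G.ofVert v g) = fv v g := by
  change Monoid.Coprod.lift (Monoid.CoprodI.lift fv) (FreeGroup.lift fe)
    (Monoid.Coprod.inl (Monoid.CoprodI.of g)) = _
  rw [Monoid.Coprod.lift_apply_inl, Monoid.CoprodI.lift_of]

theorem pathGroupLift_ofEdge (fv : ∀ v, G.vGrp v →* H) (fe : E → H)
    (h : ∀ f g, fe f * fv _ (G.toTgt f g) * (fe f)⁻¹ = fv _ (G.toSrc f g)) (f : E) :
    G.pathGroupLift fv fe h (G.ofEdge f) = fe f := by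
  change Monoid.Coprod.lift (Monoid.CoprodI.lift fv) (FreeGroup.lift fe)
    (Monoid.Coprod.inr (FreeGroup.of f)) = _
  rw [Monoid.Coprod.lift_apply_inr, FreeGroup.lift_apply_of]

variable {G}

theorem pathGroup_hom_ext {φ ψ : G.PathGroup →* H}
    (hv : ∀ v g, φ (G.ofVert v g) = ψ (G.ofVert v g))
    (he : ∀ f, φ (G.ofEdge f) = ψ (G.ofEdge f)) : φ = ψ := by
  refine QuotientGroup.monoidHom_ext _ (Monoid.Coprod.hom_ext (Monoid.CoprodI.ext_hom _ _ ?_) ?_)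
  · intro v
    ext g
    exact hv v g
  · ext f
    exact he f

end UniversalProperty

section Retractions

variable (G : GraphOfGroups.{u₁, u₂, u₃, u₄} X)

theorem exists_isPath (hX : X.Connected) (v w : V) : ∃ x, G.IsPath v w x := by
  have h := hX.2 v w
  induction h with
  | rel a b h =>
    obtain ⟨f, -, rfl, rfl⟩ := h
    exact ⟨_, .edge f⟩
  | refl a => exact ⟨_, .vert a 1⟩
  | symm a b _ ih =>
    obtain ⟨x, hx⟩ := ih
    exact ⟨_, hx.inv⟩
  | trans a b c _ _ ih₁ ih₂ =>
    obtain ⟨x, hx⟩ := ih₁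
    obtain ⟨y, hy⟩ := ih₂
    exact ⟨_, hx.mul hy⟩

/-- A choice of paths from the base point to all vertices gives a homomorphism from `F(𝒢, X)` to the
fundamental group. -/
theorem exists_hom_piOne (hX : X.Connected) (x₀ : V) :
    ∃ (ρ : G.PathGroup →* G.piOne x₀) (p : V → G.PathGroup),
      ∀ v w x, G.IsPath v w x → (ρ x : G.PathGroup) = p v * x * (p w)⁻¹ := by
  choose p hp using fun v => G.exists_isPath hX x₀ v
  let ρ : G.PathGroup →* G.piOne x₀ := G.pathGroupLift
    (fun v =>
      { toFun := fun g => ⟨p v * G.ofVert v g * (p v)⁻¹, ((hp v).mul (.vert v g)).mul (hp v).inv⟩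
        map_one' := by ext; simp
        map_mul' := fun g h => by ext; simp })
    (fun f => ⟨p (X.src f) * G.ofEdge f * (p (X.tgt f))⁻¹, ((hp _).mul (.edge f)).mul (hp _).inv⟩)
    (by
      intro f g
      ext
      simp only [Subgroup.coe_mul, Subgroup.coe_inv, MonoidHom.coe_mk, OneHom.coe_mk,
        ← G.ofEdge_mul_toTgt f g]
      group)
  refine ⟨ρ, p, fun v w x hx => ?_⟩
  induction hx with
  | vert v g => simp only [ρ, pathGroupLift_ofVert]; rfl
  | edge f => simp only [ρ, pathGroupLift_ofEdge]
  | edgeInv f =>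
    simp only [ρ, map_inv, pathGroupLift_ofEdge, Subgroup.coe_inv]
    group
  | mul _ _ h₁ h₂ =>
    rw [map_mul, Subgroup.coe_mul, h₁, h₂]
    group

/-- If the edge group of `e` is trivial, then `F(𝒢|Y, Y)` embeds in `F(𝒢, X)` for each component `Y`
of `X ∖ {e}`. -/
theorem pathGroupMap_injective {e : E} (he : Subsingleton (G.eGrp e)) {Y : X.Subgraph}
    (hY : Y.IsComponentOf (X.deleteEdge e)) : Function.Injective (G.pathGroupMap Y) := by
  classical
  obtain ⟨v₀, -, hverts, hedges⟩ := hY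
  -- Such an edge meets the component in neither end. Killing everything outside `Y` therefore
  -- respects the relators and gives a retraction; the relators of `e` hold because its group is
  -- trivial.
  have hout : ∀ f, f ∉ Y.edges → f ≠ e → X.src f ∉ Y.verts ∧ X.tgt f ∉ Y.verts := by
    intro f hf hfe
    have hsrc : X.src f ∉ Y.verts := fun h => hf (by rw [hedges]; exact ⟨hfe, h⟩)
    refine ⟨hsrc, fun h => hsrc ?_⟩
    rw [hverts] at h ⊢
    exact ⟨trivial, .trans _ _ _ h.2 (.symm _ _ (.rel _ _ ⟨f, hfe, rfl, rfl⟩))⟩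
  let fv : ∀ v, G.vGrp v →* (G.restrict Y).PathGroup := fun v =>
    if h : v ∈ Y.verts then (G.restrict Y).ofVert ⟨v, h⟩ else 1
  let fe : E → (G.restrict Y).PathGroup := fun f =>
    if h : f ∈ Y.edges then (G.restrict Y).ofEdge ⟨f, h⟩ else 1
  have hrel : ∀ f g, fe f * fv _ (G.toTgt f g) * (fe f)⁻¹ = fv _ (G.toSrc f g) := by
    intro f g
    by_cases hf : f ∈ Y.edges
    · simp only [fe, fv, dif_pos hf, dif_pos (Y.src_mem f hf), dif_pos (Y.tgt_mem f hf)]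
      exact (G.restrict Y).ofEdge_mul_toTgt ⟨f, hf⟩ g
    · by_cases hfe : f = e
      · subst hfe
        rw [Subsingleton.elim g 1, map_one, map_one, map_one, map_one, mul_one, mul_inv_cancel]
      · simp only [fe, fv, dif_neg hf, dif_neg (hout f hf hfe).1, dif_neg (hout f hf hfe).2]
        simp
  have hleft : (G.pathGroupLift fv fe hrel).comp (G.pathGroupMap Y) = MonoidHom.id _ := by
    refine pathGroup_hom_ext (fun v g => ?_) (fun f => ?_)
    · rw [MonoidHom.comp_apply, pathGroupMap_ofVert, pathGroupLift_ofVert]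
      simp only [fv, dif_pos v.2]
      rfl
    · rw [MonoidHom.comp_apply, pathGroupMap_ofEdge, pathGroupLift_ofEdge]
      simp only [fe, dif_pos f.2]
      rfl
  exact Function.LeftInverse.injective (g := G.pathGroupLift fv fe hrel)
    fun x => DFunLike.congr_fun hleft x

/-- If the edge group of `e` is trivial, then a homomorphism on `F(𝒢, X)` may be modified arbitrarily
on `e`. -/
theorem exists_hom_update {H : Type*} [Group H] {e : E} (he : Subsingleton (G.eGrp e))
    (Ψ : G.PathGroup →* H) (τ : H) :
    ∃ Φ : G.PathGroup →* H, Φ (G.ofEdge e) = τ ∧ ∀ Y : X.Subgraph, e ∉ Y.edges →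
      Φ.comp (G.pathGroupMap Y) = Ψ.comp (G.pathGroupMap Y) := by
  classical
  refine ⟨G.pathGroupLift (fun v => Ψ.comp (G.ofVert v))
    (fun f => if f = e then τ else Ψ (G.ofEdge f)) ?_, ?_, fun Y hY => ?_⟩
  · intro f g
    by_cases hf : f = e
    · subst hf
      rw [Subsingleton.elim g 1, map_one, map_one, map_one, map_one, mul_one, mul_inv_cancel]
    · simp only [if_neg hf, MonoidHom.comp_apply, ← G.ofEdge_mul_toTgt f g, map_mul, map_inv]
  · rw [pathGroupLift_ofEdge, if_pos rfl]
  · refine pathGroup_hom_ext (fun v g => ?_) (fun f => ?_)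
    · rw [MonoidHom.comp_apply, MonoidHom.comp_apply, pathGroupMap_ofVert, pathGroupLift_ofVert]
      rfl
    · rw [MonoidHom.comp_apply, MonoidHom.comp_apply, pathGroupMap_ofEdge, pathGroupLift_ofEdge,
        if_neg (fun h : f.1 = e => hY (h ▸ f.2))]

end Retractions

/-! ### The axis as a path in the graph of groups -/

section Axis

variable (G : GraphOfGroups.{u₁, u₂, u₃, u₄} X) (x₀ : V)

/-- The element of `F(𝒢, X)` given by an oriented edge. -/
def ofDir (d : E × Bool) : G.PathGroup := if d.2 then G.ofEdge d.1 else (G.ofEdge d.1)⁻¹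

theorem isPath_ofDir (d : E × Bool) : G.IsPath (X.ini d) (X.ter d) (G.ofDir d) := by
  obtain ⟨f, _ | _⟩ := d
  · exact .edgeInv f
  · exact .edge f

/-- The oriented edge of `X` below an oriented edge of the Bass–Serre tree. -/
def dirBelow (δ : G.TreeEdge x₀ × Bool) : E × Bool := (δ.1.1, δ.2)

variable {G x₀}

/-- The vertex of the Bass–Serre tree given by a path. -/
def treeVert {v : V} {q : G.PathGroup} (h : G.IsPath x₀ v q) : G.TreeVert x₀ :=
  ⟨v, QuotientGroup.mk q, q, h, rfl⟩

theorem treeVert_congr {v w : V} {q r : G.PathGroup} (hq : G.IsPath x₀ v q)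
    (hr : G.IsPath x₀ w r) (h₁ : v = w) (h₂ : q = r) : treeVert hq = treeVert hr := by
  subst h₁ h₂
  rfl

theorem eq_of_treeVert_eq {v w : V} {q r : G.PathGroup} {hq : G.IsPath x₀ v q}
    {hr : G.IsPath x₀ w r} (h : treeVert hq = treeVert hr) :
    v = w ∧ ∃ g : G.vGrp v, r = q * G.ofVert v g := by
  obtain rfl : v = w := congrArg Sigma.fst h
  refine ⟨rfl, ?_⟩
  have h' : (QuotientGroup.mk q : G.PathGroup ⧸ G.vertSubgroup v) = QuotientGroup.mk r :=
    congrArg Subtype.val (eq_of_heq (Sigma.mk.inj h).2)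
  obtain ⟨g, hg⟩ := QuotientGroup.eq.1 h'
  exact ⟨g, by rw [hg, mul_inv_cancel_left]⟩

/-- `q` represents the origin of the oriented edge `δ` of the tree, in such a way that `q` times the
edge below `δ` represents its end. -/
def IsEdgeRep (δ : G.TreeEdge x₀ × Bool) (q : G.PathGroup) : Prop :=
  ∃ p, G.IsPath x₀ (X.src δ.1.1) p ∧ QuotientGroup.mk p = δ.1.2.1 ∧
    q = if δ.2 then p else p * G.ofEdge δ.1.1

theorem exists_isEdgeRep (δ : G.TreeEdge x₀ × Bool) : ∃ q, IsEdgeRep δ q := by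
  obtain ⟨p, hp, h⟩ := δ.1.2.2
  exact ⟨_, p, hp, h, rfl⟩

theorem IsEdgeRep.isPath {δ : G.TreeEdge x₀ × Bool} {q : G.PathGroup} (h : IsEdgeRep δ q) :
    G.IsPath x₀ (X.ini (G.dirBelow x₀ δ)) q := by
  obtain ⟨ε, _ | _⟩ := δ
  · obtain ⟨p, hp, -, rfl⟩ := h
    exact hp.mul (.edge _)
  · obtain ⟨p, hp, -, rfl⟩ := h
    exact hp

theorem IsEdgeRep.ini_eq {δ : G.TreeEdge x₀ × Bool} {q : G.PathGroup} (h : IsEdgeRep δ q) :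
    (G.tree x₀).ini δ = treeVert h.isPath := by
  obtain ⟨⟨f, c, hc⟩, _ | _⟩ := δ
  · obtain ⟨p, hp, hc', hq⟩ := id h
    change QuotientGroup.mk p = c at hc'
    subst hc' hq
    rfl
  · obtain ⟨p, hp, hc', hq⟩ := id h
    change QuotientGroup.mk p = c at hc'
    subst hc' hq
    rfl

theorem IsEdgeRep.ter_eq {δ : G.TreeEdge x₀ × Bool} {q : G.PathGroup} (h : IsEdgeRep δ q) :
    (G.tree x₀).ter δ = treeVert (h.isPath.mul (G.isPath_ofDir _)) := by
  obtain ⟨⟨f, c, hc⟩, _ | _⟩ := δ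
  · obtain ⟨p, hp, hc', hq⟩ := id h
    change QuotientGroup.mk p = c at hc'
    subst hc' hq
    have h' : G.IsPath x₀ (X.src f) p := hp
    exact treeVert_congr h' (h.isPath.mul (G.isPath_ofDir _)) rfl
      (by simp [ofDir, dirBelow])
  · obtain ⟨p, hp, hc', hq⟩ := id h
    change QuotientGroup.mk p = c at hc'
    subst hc' hq
    rfl

theorem IsEdgeRep.smul {δ : G.TreeEdge x₀ × Bool} {q : G.PathGroup} (h : IsEdgeRep δ q)
    (R : G.piOne x₀) : IsEdgeRep (R • δ.1, δ.2) (R * q) := by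
  obtain ⟨p, hp, hpq, rfl⟩ := h
  refine ⟨R * p, IsPath.mul R.2 hp, ?_, ?_⟩
  · change _ = R.1 • δ.1.2.1
    rw [← hpq]
    rfl
  · obtain ⟨ε, _ | _⟩ := δ
    · exact (mul_assoc _ _ _).symm
    · rfl

/-- Representatives differ by an element of the edge group, so triviality makes them unique; this
turns translation by `R` into an exact equality in F(𝒢, X). -/
theorem IsEdgeRep.eq {δ : G.TreeEdge x₀ × Bool} {q r : G.PathGroup} (hq : IsEdgeRep δ q)
    (hr : IsEdgeRep δ r) (h : Subsingleton (G.eGrp δ.1.1)) : q = r := by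
  obtain ⟨p, -, hp, rfl⟩ := hq
  obtain ⟨p', -, hp', rfl⟩ := hr
  obtain ⟨g, hg⟩ := QuotientGroup.eq.1 (hp.trans hp'.symm)
  rw [Subsingleton.elim g 1, map_one, eq_comm, inv_mul_eq_one] at hg
  rw [hg]

/-- An axis in the Bass–Serre tree, written as an infinite path in the graph of groups. -/
theorem IsAxis.exists_path {R : G.piOne x₀} {α : ℤ → G.TreeEdge x₀ × Bool} {k : ℕ}
    (h : G.IsAxis x₀ R α k) : ∃ q : ℤ → G.PathGroup,
      (∀ n, X.ter (G.dirBelow x₀ (α n)) = X.ini (G.dirBelow x₀ (α (n + 1)))) ∧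
      (∀ n, ∃ g, q (n + 1) = q n * G.ofDir (G.dirBelow x₀ (α n)) *
        G.ofVert (X.ter (G.dirBelow x₀ (α n))) g) ∧
      (∀ n j, X.ter (G.dirBelow x₀ (α n)) = X.ini (G.dirBelow x₀ (α j)) →
        q n * G.ofDir (G.dirBelow x₀ (α n)) = q j → n + 1 = j) ∧
      ∀ n, Subsingleton (G.eGrp (α n).1.1) → q (n + k) = R * q n := by
  choose q hq using fun n => exists_isEdgeRep (α n)
  have hchain : ∀ n, treeVert ((hq n).isPath.mul (G.isPath_ofDir _)) =
      treeVert (hq (n + 1)).isPath := fun n => by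
    rw [← (hq n).ter_eq, ← (hq (n + 1)).ini_eq, h.chain]
  refine ⟨q, fun n => (eq_of_treeVert_eq (hchain n)).1, fun n => (eq_of_treeVert_eq (hchain n)).2,
    fun n j h₁ h₂ => ?_, fun n hn => ?_⟩
  -- Equal representatives over one vertex of X are one vertex of the tree, which the axis visits
  -- only once.
  · apply h.distinct
    change (G.tree x₀).ini _ = (G.tree x₀).ini _
    rw [← h.chain, (hq n).ter_eq, (hq j).ini_eq]
    exact treeVert_congr _ _ h₁ h₂
  · have h₁ : IsEdgeRep (α (n + k)) (R * q n) := by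
      rw [h.shift]
      exact (hq n).smul R
    refine (hq (n + k)).eq h₁ ?_
    rw [h.shift]
    exact hn

end Axis

end GraphOfGroups

/-! ### Cyclic words in F(ι) * ⟨none⟩ -/

namespace FreeGroup

variable {ι : Type u}

/-- A cyclic word in `F(ι) * ⟨none⟩` without backtracking is represented by a cyclically reduced
word. -/
theorem exists_isCyclicallyReduced_of_isChain (x y : Bool × FreeGroup ι)
    (l : List (Bool × FreeGroup ι)) (hxy : x.1 = y.1)
    (h : ((x :: l) ++ [y]).IsChain fun a b => a.1 ≠ b.1 → a.2 ≠ 1) :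
    ∃ L : List (Option ι × Bool), IsCyclicallyReduced L ∧ none ∈ L.map Prod.fst ∧
      mk L = ((x :: l).map fun a =>
        (if a.1 then of none else (of none)⁻¹) * map some a.2).prod := by
  classical
  let B : Bool × FreeGroup ι → List (Option ι × Bool) := fun a =>
    (none, a.1) :: a.2.toWord.map fun c => (some c.1, c.2)
  have hmap : ∀ v : FreeGroup ι, mk (v.toWord.map fun c => (some c.1, c.2)) = map some v := by
    intro v
    conv_rhs => rw [← mk_toWord (x := v), map.mk]
  -- Cancellation where two blocks meet needs the first block to end in `none`, hence to have
  -- trivial coefficient; the chain condition then forces equal directions.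
  have hlast : ∀ a : Bool × FreeGroup ι, a.2 ≠ 1 → ∀ c ∈ (B a).getLast?, c.1 ≠ none := by
    intro a ha c hc
    have hne : a.2.toWord ≠ [] := fun h => ha (toWord_eq_nil_iff.1 h)
    obtain ⟨w, z, hw⟩ := (List.eq_nil_or_concat' a.2.toWord).resolve_left hne
    simp only [B, hw, List.map_append, List.map_cons, List.map_nil, ← List.cons_append,
      List.getLast?_append, List.getLast?_singleton, Option.some_or, Option.mem_def,
      Option.some.injEq] at hc
    rw [← hc]
    simp
  have hB : ∀ a, IsReduced (B a) := by
    intro a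
    refine List.isChain_cons.2 ⟨fun c hc => ?_, ?_⟩
    · have hc' := List.mem_of_mem_head? hc
      obtain ⟨z, -, rfl⟩ := List.mem_map.1 hc'
      intro h
      cases h
    · refine List.isChain_map _ |>.2 ?_
      exact isReduced_toWord.imp fun c d hcd h => hcd (Option.some_injective _ h)
  have hchain : ∀ m : List (Bool × FreeGroup ι), (m.IsChain fun a b => a.1 ≠ b.1 → a.2 ≠ 1) →
      IsReduced (m.map B).flatten := by
    intro m hm
    refine (List.isChain_flatten (by simp [B])).2 ⟨?_, ?_⟩
    · intro w hw
      obtain ⟨a, -, rfl⟩ := List.mem_map.1 hw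
      exact hB a
    · refine List.isChain_map _ |>.2 (hm.imp fun a b hab => ?_)
      intro c hc d hd hcd
      have hd' : d = (none, b.1) := by simpa [B, eq_comm] using hd
      subst hd'
      have ha : a.2 = 1 := by
        by_contra ha
        exact hlast a ha c hc hcd
      have hc' : c = (none, a.1) := by simpa [B, ha, eq_comm] using hc
      subst hc'
      by_contra hne
      exact hab hne ha
  -- The block of `y` starts with the same letter as that of `x`, so reducedness with `y` appended
  -- includes the wrap-around condition.
  have hred := hchain _ h
  rw [List.map_append, List.flatten_append] at hred
  have hred' := List.isChain_append.1 hred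
  refine ⟨((x :: l).map B).flatten, ⟨hred'.1, fun a ha b hb => ?_⟩, by simp [B], ?_⟩
  · refine hred'.2.2 a ha b ?_
    simpa [B, ← hxy] using hb
  · clear hred hred' h
    induction (x :: l) with
    | nil => rfl
    | cons a m ih =>
      have h₁ : mk (B a) = (if a.1 then of none else (of none)⁻¹) * map some a.2 := by
        rw [← hmap]
        obtain ⟨_ | _, v⟩ := a
        · rfl
        · rfl
      rw [List.map_cons, List.flatten_cons, ← mul_mk, ih, h₁, List.map_cons, List.prod_cons]

end FreeGroup

/-! ### The cyclic word of `R` -/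

namespace GraphOfGroups

variable {V : Type u₁} {E : Type u₂} {X : OrGraph V E} {G : GraphOfGroups.{u₁, u₂, u₃, u₄} X}
  {x₀ : V}

/-- The element `R`, if its axis contains an edge over `e`, is conjugate in `F(𝒢, X)` to a cyclic
word in `e` and in paths of `X ∖ {e}`, without backtracking along `e`. -/
theorem IsAxis.exists_cyclic_word {R : G.piOne x₀} {α : ℤ → G.TreeEdge x₀ × Bool} {k : ℕ}
    (h : G.IsAxis x₀ R α k) {e : E} (he : Subsingleton (G.eGrp e)) (i : ℤ) (hi : (α i).1.1 = e)
    {H : Type*} [Group H] (ρ : G.PathGroup →* H)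
    (hρ : ∀ v u, G.IsPath v v u → ρ u = 1 → u = 1) :
    ∃ (q : G.PathGroup) (x y : Bool × G.PathGroup) (l : List (Bool × G.PathGroup)), x.1 = y.1 ∧
      (((x :: l) ++ [y]).IsChain fun a b => a.1 ≠ b.1 → ρ a.2 ≠ 1) ∧
      (∀ a ∈ x :: l, a.2 ∈ (G.pathGroupMap (X.deleteEdge e)).range) ∧
      q⁻¹ * R * q = ((x :: l).map fun a => G.ofDir (e, a.1) * a.2).prod := by
  obtain ⟨q, hadj, hstep, hdist, hshift⟩ := h.exists_path
  have hvert : ∀ v g, G.ofVert v g ∈ (G.pathGroupMap (X.deleteEdge e)).range := fun v g =>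
    ⟨_, G.pathGroupMap_ofVert (X.deleteEdge e) ⟨v, trivial⟩ g⟩
  have hedge : ∀ d : E × Bool, d.1 ≠ e →
      G.ofDir d ∈ (G.pathGroupMap (X.deleteEdge e)).range := by
    rintro ⟨f, b⟩ hf
    have hmem : G.ofEdge f ∈ (G.pathGroupMap (X.deleteEdge e)).range :=
      ⟨_, G.pathGroupMap_ofEdge (X.deleteEdge e) ⟨f, hf⟩⟩
    cases b
    · exact inv_mem hmem
    · exact hmem
  have hstep' : ∀ n, ∃ u, u ∈ (G.pathGroupMap (X.deleteEdge e)).range ∧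
      G.IsPath (X.ter (G.dirBelow x₀ (α n))) (X.ini (G.dirBelow x₀ (α (n + 1)))) u ∧
      q (n + 1) = q n * G.ofDir (G.dirBelow x₀ (α n)) * u := by
    intro n
    obtain ⟨g, hg⟩ := hstep n
    refine ⟨_, hvert _ g, ?_, hg⟩
    rw [← hadj]
    exact .vert _ g
  -- Between crossings of `e` in opposite directions, `u` is a closed path, so a trivial ρ u gives u
  -- = 1. The end of edge n + 1 would then be the origin of edge j, against injectivity of the axis.
  have hpinch : ∀ (j n : ℤ) (u : G.PathGroup), j ≤ n → (α j).1.1 = e → (α (n + 1)).1.1 = e →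
      G.IsPath (X.ter (e, (α j).2)) (X.ini (G.dirBelow x₀ (α (n + 1)))) u →
      q (n + 1) = q j * G.ofDir (e, (α j).2) * u →
      (α j).2 ≠ (α (n + 1)).2 → ρ u ≠ 1 := by
    intro j n u hjn hj hn hu hq hne hρu
    have hdn : G.dirBelow x₀ (α (n + 1)) = (e, !(α j).2) := by
      refine Prod.ext hn ?_
      change (α (n + 1)).2 = !(α j).2
      cases h₁ : (α j).2 <;> cases h₂ : (α (n + 1)).2 <;> simp_all
    have hdj : G.dirBelow x₀ (α j) = (e, (α j).2) := Prod.ext hj rfl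
    have hturn : ∀ b, X.ini (e, !b) = X.ter (e, b) := by rintro (_ | _) <;> rfl
    have hturn' : ∀ b, X.ter (e, !b) = X.ini (e, b) := by rintro (_ | _) <;> rfl
    have hback : ∀ b, G.ofDir (e, b) * G.ofDir (e, !b) = 1 := by
      rintro (_ | _) <;> simp [ofDir]
    rw [hdn, hturn] at hu
    have hu1 := hρ _ u hu hρu
    rw [hu1, mul_one] at hq
    have := hdist (n + 1) j (by rw [hdn, hdj, hturn'])
      (by rw [hdn, hq, mul_assoc, hback, mul_one])
    omega
  -- The last syllable is kept open: `j` is the latest crossing of `e` so far and `u` the path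
  -- followed since.
  have hmain : ∀ n : ℕ, ∃ (l : List (Bool × G.PathGroup)) (j : ℤ) (u : G.PathGroup),
      ((l ++ [((α j).2, u)]).IsChain fun a b => a.1 ≠ b.1 → ρ a.2 ≠ 1) ∧
      (∀ a ∈ l ++ [((α j).2, u)], a.2 ∈ (G.pathGroupMap (X.deleteEdge e)).range) ∧
      (∃ x l', l ++ [((α j).2, u)] = x :: l' ∧ x.1 = (α i).2) ∧
      (q i)⁻¹ * q (i + n + 1) =
        ((l ++ [((α j).2, u)]).map fun a => G.ofDir (e, a.1) * a.2).prod ∧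
      j ≤ i + n ∧ (α j).1.1 = e ∧
      G.IsPath (X.ter (e, (α j).2)) (X.ini (G.dirBelow x₀ (α (i + n + 1)))) u ∧
      q (i + n + 1) = q j * G.ofDir (e, (α j).2) * u := by
    intro n
    induction n with
    | zero =>
      obtain ⟨w, hw, hpath, hg⟩ := hstep' i
      have hdi : G.dirBelow x₀ (α i) = (e, (α i).2) := Prod.ext hi rfl
      rw [hdi] at hpath hg
      refine ⟨[], i, w, by simp, ?_, ⟨_, _, rfl, rfl⟩, ?_, by simp, hi, ?_, ?_⟩
      · simpa using hw
      · rw [Nat.cast_zero, add_zero, hg]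
        simp [mul_assoc]
      · rwa [Nat.cast_zero, add_zero]
      · rw [Nat.cast_zero, add_zero, hg]
    | succ n ih =>
      obtain ⟨l, j, u, hch, hmem, ⟨x, l', hxl, hx⟩, hprod, hj, hje, hu, hq⟩ := ih
      have hcast : i + ((n + 1 : ℕ) : ℤ) + 1 = i + n + 1 + 1 := by push_cast; ring
      rw [hcast]
      obtain ⟨w, hw, hpath, hg⟩ := hstep' (i + n + 1)
      by_cases hn : (α (i + n + 1)).1.1 = e
      · have hd : G.dirBelow x₀ (α (i + n + 1)) = (e, (α (i + n + 1)).2) := Prod.ext hn rfl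
        rw [hd] at hpath hg
        refine ⟨l ++ [((α j).2, u)], i + n + 1, w, ?_, ?_, ?_, ?_, ?_, hn, ?_, ?_⟩
        · refine List.isChain_append.2 ⟨hch, by simp, fun a ha b hb => ?_⟩
          simp only [List.getLast?_append, List.getLast?_singleton, Option.some_or,
            Option.mem_def, Option.some.injEq] at ha
          simp only [List.head?_cons, Option.mem_def, Option.some.injEq] at hb
          subst ha hb
          exact hpinch j (i + n) u hj hje hn hu hq
        · intro a ha
          rcases List.mem_append.1 ha with ha | ha
          · exact hmem a ha
          · rw [List.mem_singleton.1 ha]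
            exact hw
        · rw [hxl]
          exact ⟨_, _, rfl, hx⟩
        · rw [List.map_append, List.prod_append, ← hprod, hg]
          simp [mul_assoc]
        · push_cast; omega
        · exact hpath
        · exact hg
      · refine ⟨l, j, u * G.ofDir (G.dirBelow x₀ (α (i + n + 1))) * w, ?_, ?_, ?_, ?_,
          by push_cast; omega, hje, ?_, ?_⟩
        · rw [List.isChain_append] at hch ⊢
          refine ⟨hch.1, by simp, fun a ha b hb => ?_⟩
          have := hch.2.2 a ha _ (by simp; rfl)
          simp only [List.head?_cons, Option.mem_def, Option.some.injEq] at hb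
          subst hb
          exact this
        · intro a ha
          rcases List.mem_append.1 ha with ha | ha
          · exact hmem a (List.mem_append_left _ ha)
          · rw [List.mem_singleton.1 ha]
            exact mul_mem (mul_mem (hmem _ (List.mem_append_right _ (List.mem_singleton_self _)))
              (hedge _ hn)) hw
        · cases l with
          | nil =>
            rw [List.nil_append] at hxl
            obtain ⟨rfl, -⟩ := List.cons.inj hxl
            exact ⟨_, _, rfl, hx⟩
          | cons z l =>
            obtain ⟨rfl, -⟩ := List.cons.inj hxl
            exact ⟨_, _, rfl, hx⟩
        · rw [List.map_append, List.prod_append] at hprod ⊢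
          rw [hg, mul_assoc (q _), ← mul_assoc _ (q _), hprod]
          simp [mul_assoc]
        · exact (hu.mul (G.isPath_ofDir _)).mul hpath
        · rw [hg, hq]
          simp only [mul_assoc]
  -- One full period, ending at q (i + k) = R q i.
  obtain ⟨l, j, u, hch, hmem, ⟨x, l', hxl, hx⟩, hprod, hj, hje, hu, hq⟩ := hmain (k - 1)
  have hk : i + ((k - 1 : ℕ) : ℤ) + 1 = i + k := by
    have := h.pos
    omega
  have hαk : α (i + k) = (R • (α i).1, (α i).2) := h.shift i
  have hαe : (α (i + k)).1.1 = e := by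
    rw [hαk]
    exact hi
  rw [hk] at hprod hq hu
  rw [hshift i (hi ▸ he), ← mul_assoc] at hprod
  refine ⟨q i, x, ((α i).2, 1), l', hx, ?_, by rwa [← hxl], by rwa [← hxl]⟩
  rw [← hxl]
  refine List.isChain_append.2 ⟨hch, by simp, fun a ha b hb => ?_⟩
  simp only [List.getLast?_append, List.getLast?_singleton, Option.some_or, Option.mem_def,
    Option.some.injEq] at ha
  simp only [List.head?_cons, Option.mem_def, Option.some.injEq] at hb
  subst ha hb
  intro hne
  rw [← hk] at hu hq hαe hαk
  exact hpinch j _ u hj hje hαe hu hq (by rwa [hαk])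

/-- The length is read off a chosen axis, and only one crossing of `e` on it is needed, so
uniqueness of the axis plays no role. -/
theorem exists_isAxis_of_eLength_pos {e : E} {R : G.piOne x₀} (hR : 0 < G.eLength x₀ e R) :
    ∃ (α : ℤ → G.TreeEdge x₀ × Bool) (k : ℕ) (i : ℤ), G.IsAxis x₀ R α k ∧ (α i).1.1 = e := by
  classical
  rw [eLength] at hR
  split_ifs at hR with h
  · obtain ⟨i, hi⟩ := Finset.card_pos.1 hR
    exact ⟨_, _, i, h.choose_spec, (Finset.mem_filter.1 hi).2⟩
  · exact absurd hR (lt_irrefl 0)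

end GraphOfGroups

/-! ### The proposition -/

theorem proposition2p1 {V : Type u₁} {E : Type u₂} (X : OrGraph V E) (hX : X.Connected)
    (G : GraphOfGroups.{u₁, u₂, u₃, u₄} X) (x₀ : V) (hΓ : IsLimitGroup (G.piOne x₀))
    (e : E) (he : Subsingleton (G.eGrp e))
    (Y : X.Subgraph) (hY : Y.IsComponentOf (X.deleteEdge e))
    (y₀ : Y.verts) (c : G.PathGroup) (hc : G.IsPath x₀ y₀.1 c)
    (R : G.piOne x₀) (hR : 0 < G.eLength x₀ e R) :
    Function.Injective
      ((QuotientGroup.mk' (Subgroup.normalClosure {R})).comp (G.piOneMap Y y₀ x₀ c hc)) := by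
  classical
  rw [injective_iff_map_eq_one]
  intro a ha
  have haN : G.piOneMap Y y₀ x₀ c hc a ∈ Subgroup.normalClosure {R} :=
    (QuotientGroup.eq_one_iff _).1 ha
  have heY : e ∉ Y.edges := by
    obtain ⟨v, -, -, hedges⟩ := hY
    rw [hedges]
    exact fun h => h.1 rfl
  obtain ⟨ρ, p, hρ⟩ := G.exists_hom_piOne hX x₀
  -- On closed paths `ρ` is conjugation by the chosen path.
  have hρ1 : ∀ v u, G.IsPath v v u → ρ u = 1 → u = 1 := by
    intro v u hu h
    have h' := hρ v v u hu
    rw [h, Subgroup.coe_one] at h'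
    exact conj_eq_one_iff.1 h'.symm
  obtain ⟨α, k, i, hα, hi⟩ := GraphOfGroups.exists_isAxis_of_eLength_pos hR
  obtain ⟨q, x, y, l, hxy, hchain, hmem, hprod⟩ := hα.exists_cyclic_word he i hi ρ hρ1
  set b := G.pathGroupMap Y a.1
  -- Including 1 turns injectivity on the finite set into nontriviality of the images of its other
  -- elements.
  obtain ⟨ι, ψ, hψ⟩ := hΓ.2
    (insert 1 (insert (ρ b) (((x :: l) ++ [y]).map fun z => ρ z.2).toFinset))
  have hψ1 : ∀ z, z = ρ b ∨ z ∈ ((x :: l) ++ [y]).map (fun z => ρ z.2) → ψ z = 1 → z = 1 := by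
    intro z hz h
    refine hψ ?_ (by simp) (h.trans (map_one ψ).symm)
    rcases hz with rfl | hz
    · simp
    · simp only [Finset.coe_insert, List.coe_toFinset]
      exact Or.inr (Or.inr hz)
  let Ψ : G.PathGroup →* FreeGroup (Option ι) := (FreeGroup.map some).comp (ψ.comp ρ)
  -- `Φ` agrees with `Ψ` away from `e`, so the coefficients and `b` land in F(ι), while `e` becomes
  -- the new letter.
  obtain ⟨Φ, hΦe, hΦ⟩ := G.exists_hom_update he Ψ (FreeGroup.of none)
  let T : Bool × G.PathGroup → Bool × FreeGroup ι := fun z => (z.1, ψ (ρ z.2))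
  obtain ⟨L, hL, hnone, hLprod⟩ := FreeGroup.exists_isCyclicallyReduced_of_isChain (T x) (T y)
    (l.map T) hxy (by
      have hT : (T x :: l.map T) ++ [T y] = ((x :: l) ++ [y]).map T := by simp
      rw [hT, List.isChain_map]
      refine hchain.imp_of_mem_imp fun z z' hz _ hzz' hne h => hzz' hne (hψ1 _ (Or.inr ?_) h)
      exact List.mem_map.2 ⟨z, hz, rfl⟩)
  have hΦR : Φ (q⁻¹ * R * q) = FreeGroup.mk L := by
    rw [hLprod, hprod, map_list_prod, ← List.map_cons, List.map_map, List.map_map]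
    refine congrArg List.prod (List.map_congr_left fun z hz => ?_)
    obtain ⟨w, hw⟩ := hmem z hz
    have h₁ : Φ z.2 = Ψ z.2 := by
      rw [← hw]
      exact DFunLike.congr_fun (hΦ (X.deleteEdge e) fun h => h rfl) w
    obtain ⟨_ | _, z⟩ := z
    · change Φ (_ * z) = _
      rw [map_mul, h₁]
      change Φ (G.ofEdge e)⁻¹ * _ = _
      rw [map_inv, hΦe]
      rfl
    · change Φ (_ * z) = _
      rw [map_mul, h₁]
      change Φ (G.ofEdge e) * _ = _
      rw [hΦe]
      rfl
  have hN : ∀ z ∈ Subgroup.normalClosure {R},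
      Φ z.1 ∈ Subgroup.normalClosure {FreeGroup.mk L} := by
    intro z hz
    refine Subgroup.normalClosure_le_normal
      (N := (Subgroup.normalClosure {FreeGroup.mk L}).comap (Φ.comp (G.piOne x₀).subtype))
      (Set.singleton_subset_iff.2 ?_) hz
    have hmL : FreeGroup.mk L ∈ Subgroup.normalClosure {FreeGroup.mk L} :=
      Subgroup.subset_normalClosure (Set.mem_singleton _)
    rw [← hΦR] at hmL ⊢
    have := Subgroup.normalClosure_normal.conj_mem _ hmL (Φ q)
    rw [← map_inv, ← map_mul, ← map_mul] at this
    simpa [mul_assoc] using this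
  have hbN : Ψ b ∈ Subgroup.normalClosure {FreeGroup.mk L} := by
    have h₁ : Φ b = Ψ b := DFunLike.congr_fun (hΦ Y heY) a.1
    have h₂ : Φ (c * b * c⁻¹) ∈ Subgroup.normalClosure {FreeGroup.mk L} := hN _ haN
    -- The connecting path `c` disappears because the normal closure is invariant under conjugation
    -- by Φ c.
    have := Subgroup.normalClosure_normal.conj_mem _ h₂ (Φ c)⁻¹
    rw [← h₁]
    simpa [mul_assoc] using this
  have hone : ψ (ρ b) = 1 := by
    let s : ι → {o : Option ι // o ≠ none} := fun j => ⟨some j, Option.some_ne_none j⟩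
    have hs : FreeGroup.map Subtype.val (FreeGroup.map s (ψ (ρ b))) = Ψ b := by
      rw [FreeGroup.map.comp]
      rfl
    have h := FreeGroup.freiheitssatz L hL none hnone (FreeGroup.map s (ψ (ρ b))) (hs ▸ hbN)
    exact FreeGroup.map_injective
      (fun j j' hj => Option.some_injective _ (congrArg Subtype.val hj)) (h.trans (map_one _).symm)
  have hb1 : b = 1 := hρ1 _ b (GraphOfGroups.IsPath.map a.2) (hψ1 _ (Or.inl rfl) hone)
  exact Subtype.ext (G.pathGroupMap_injective he hY (hb1.trans (map_one _).symm))
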